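/- Let $d\in\{2,3\}$ and $\sigma>0$. There is $\alpha_{\min}>0$, depending only on $d$ and $\sigma$, such that for all $\alpha_0\ge\alpha_{\min}$ and $\alpha_1>0$ there is a constant $\gamma\in[0,1)$, depending only on $d,\sigma,\alpha_0,\alpha_1$, with the following property. Let $\mathcal T_h$ be any finite conforming partition (no hanging nodes) of a polygon or polyhedron $\Omega\subset\mathbb R^d$ into closed nondegenerate $d$-simplices that is shape regular with constant $\sigma$: every $T\in\mathcal T_h$ contains a ball of radius $\operatorname{diam}(T)/\sigma$. Let $\mathcal E^o$ and $\mathcal E^\partial$ be the sets of interior and of boundary faces, and let $\mathcal E^\partial=\mathcal E^D\cup\mathcal E^N$ be any partition into Dirichlet and Neumann faces (pure displacement $\mathcal E^N=\emptyset$, mixed, and traction free $\mathcal E^D=\emptyset$ are all allowed). Fix a unit normal $\mathbf n_E$ of each face $E$, outward on boundary faces. On an interior face, let $\mathbf w^{\pm}$ be the traces of $\mathbf w$ from the cells $T^\pm$ whose outward normal on $E$ is $\pm\mathbf n_E$, and put $\{\mathbf w\}=\frac12(\mathbf w^++\mathbf w^-)$, $[\mathbf w]=\mathbf w^+-\mathbf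 w^-$; on a boundary face $\{\mathbf w\}=[\mathbf w]=\mathbf w$. Let $\mathcal P^0_E\mathbf w=\frac1{|E|}\int_E\mathbf w$ and $h_E=\operatorname{diam}E$. Let $V^{DG}$ be the space of vector fields $\Omega\to\mathbb R^d$ that are affine on each $T\in\mathcal T_h$, with no continuity condition, and $$V^{CR}=\{\mathbf v\in V^{DG}:\mathcal P^0_E[\mathbf v]=0\ \ \forall E\in\mathcal E^o\cup\mathcal E^D\},\qquad \mathcal Z=\{\mathbf z\in V^{DG}:\mathcal P^0_E\{\mathbf z\}=0\ \ \forall E\in\mathcal E^o\cup\mathcal E^N\}.$$ Let $\mu>0$, $\lambda\ge0$, $\varepsilon(\mathbf u)=\frac12(\nabla\mathbf u+\nabla\mathbf u^{T})$, $\mathcal C A=2\mu A+\lambda\operatorname{tr}(A)I$, $\beta_0=d\lambda+2\mu$, $\beta_1=2\mu$, and let $\mathcal A$ be the symmetric IP-1 bilinear form $$\begin{aligned}\mathcal A(\mathbf u,\mathbf w)=&\sum_{T\in\mathcal T_h}\int_T\mathcal C\varepsilon(\mathbf u):\varepsilon(\mathbf w)-\sum_{E\in\mathcal E^o\cup\mathcal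 E^D}\int_E\big(\langle\{(\mathcal C\varepsilon(\mathbf u))\mathbf n_E\},[\mathbf w]\rangle+\langle[\mathbf u],\{(\mathcal C\varepsilon(\mathbf w))\mathbf n_E\}\rangle\big)\\&+\sum_{E\in\mathcal E^o\cup\mathcal E^D}\int_E h_E^{-1}\big(\alpha_0\beta_0\langle[\mathbf u],\mathcal P^0_E[\mathbf w]\rangle+\alpha_1\beta_1\langle[\mathbf u],[\mathbf w]\rangle\big).\end{aligned}$$ Then $V^{DG}=V^{CR}\oplus\mathcal Z$. Write $\mathcal A((\mathbf z,\mathbf v),(\boldsymbol\zeta,\boldsymbol\varphi))=\mathcal A(\mathbf z+\mathbf v,\boldsymbol\zeta+\boldsymbol\varphi)$ and $\mathcal B((\mathbf z,\mathbf v),(\boldsymbol\zeta,\boldsymbol\varphi))=\mathcal A(\mathbf z,\boldsymbol\zeta)+\mathcal A(\mathbf v,\boldsymbol\varphi)$. For all $\mathbf z\in\mathcal Z$ and $\mathbf v\in V^{CR}$, $$\mathcal A(\mathbf z,\mathbf v)^2\le\gamma^2\,\mathcal A(\mathbf z,\mathbf z)\,\mathcal A(\mathbf v,\mathbf v),$$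 $$\frac1{1+\gamma}\mathcal A((\mathbf z,\mathbf v),(\mathbf z,\mathbf v))\le\mathcal B((\mathbf z,\mathbf v),(\mathbf z,\mathbf v))\le\frac1{1-\gamma}\mathcal A((\mathbf z,\mathbf v),(\mathbf z,\mathbf v)).$$ In particular the bounds are uniform in the mesh size, in $\lambda$ and in $\mu$. -/

import Mathlib

open scoped MeasureTheory

noncomputable section

namespace DGElasticity

/-- The Euclidean space `ℝᵈ` (points, displacements and normals). -/
abbrev Vec (d : ℕ) : Type := EuclideanSpace ℝ (Fin d)

/-- The closed simplex spanned by a finite set of vertices. -/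
abbrev hull {d : ℕ} (S : Finset (Vec d)) : Set (Vec d) := convexHull ℝ (S : Set (Vec d))

/-- A conforming simplicial partition (no hanging nodes) of a polygon or polyhedron in `ℝᵈ`.
A cell is given by its `d + 1` vertices; the closure of the partitioned domain `Ω` is the union of
the closed simplices `hull T`, and `Ω` is the interior of this union.
Two closed cells meet exactly in the simplex spanned by their common vertices. -/
structure Mesh (d : ℕ) where
  cells : Finset (Finset (Vec d))
  card_eq : ∀ T ∈ cells, T.card = d + 1
  indep : ∀ T ∈ cells, AffineIndependent ℝ ((↑) : T → Vec d)
  conforming : ∀ T ∈ cells, ∀ T' ∈ cells,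
    hull T ∩ hull T' = convexHull ℝ ((T : Set (Vec d)) ∩ (T' : Set (Vec d)))

/-- `n` is the unit normal vector to the face `E` of the cell `T` that is outward with respect
to `T`. -/
def IsOutwardNormal {d : ℕ} (T E : Finset (Vec d)) (n : Vec d) : Prop :=
  ‖n‖ = 1 ∧ (∀ x ∈ E, ∀ y ∈ E, inner ℝ n (y - x) = 0) ∧
    ∀ x ∈ E, ∀ y ∈ T, y ∉ E → inner ℝ n (y - x) < 0

namespace Mesh

variable {d : ℕ} (M : Mesh d)

/-- Shape regularity with constant `σ`: every cell `T` contains a ball of radius `h_T / σ`, where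
`h_T` is the diameter of `T`. -/
def ShapeRegular (σ : ℝ) : Prop :=
  ∀ T ∈ M.cells, ∃ c : Vec d, Metric.closedBall c (Metric.diam (hull T) / σ) ⊆ hull T

open Classical in
/-- All faces: the `(d - 1)`-dimensional simplices spanned by `d` vertices of a cell. -/
def faces : Finset (Finset (Vec d)) := M.cells.biUnion fun T => T.powersetCard d

open Classical in
/-- The cells that contain the face `E`. -/
def cellsAt (E : Finset (Vec d)) : Finset (Finset (Vec d)) := M.cells.filter fun T => E ⊆ T

open Classical in
/-- Interior faces: those shared by two cells. -/
def interiorFaces : Finset (Finset (Vec d)) := M.faces.filter fun E => (M.cellsAt E).card = 2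

open Classical in
/-- Boundary faces: those that belong to one cell only. -/
def boundaryFaces : Finset (Finset (Vec d)) := M.faces.filter fun E => (M.cellsAt E).card = 1

open Classical in
/-- Interior faces together with the Dirichlet faces `D`. -/
def interiorOrDirichlet (D : Finset (Finset (Vec d))) : Finset (Finset (Vec d)) :=
  M.interiorFaces ∪ D

open Classical in
/-- Interior faces together with the Neumann faces, the boundary faces which are not Dirichlet
faces. -/
def interiorOrNeumann (D : Finset (Finset (Vec d))) : Finset (Finset (Vec d)) :=
  M.interiorFaces ∪ (M.boundaryFaces \ D)

/-- A choice of a unit normal vector for every face: for an interior face either of the two unit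
normals, for a boundary face the one that points outward. -/
structure FaceNormals where
  normal : Finset (Vec d) → Vec d
  norm_eq : ∀ E ∈ M.faces, ‖normal E‖ = 1
  orthogonal : ∀ E ∈ M.faces, ∀ x ∈ E, ∀ y ∈ E, inner ℝ (normal E) (y - x) = 0
  outward : ∀ E ∈ M.boundaryFaces, ∀ T ∈ M.cellsAt E, IsOutwardNormal T E (normal E)

/-- The space of piecewise linear, discontinuous vector fields: one affine vector field on each
cell. (Cells have non-empty interior and overlap in null sets only, so that such a family is the
same thing as an element of `L²(Ω)ᵈ` whose restriction to every cell is affine.)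
For `u : M.VDG` and a cell `T`, `u T x` is the value, or the trace taken from within `T`, at `x`. -/
abbrev VDG : Type := M.cells → (Vec d →ᵃ[ℝ] Vec d)

variable {M} (𝔫 : M.FaceNormals)

section Traces

variable {X : Type*} [AddCommGroup X] [Module ℝ X]

open Classical in
/-- `T⁺(E)`, as a set with at most one element. -/
def plusCells (E : Finset (Vec d)) : Finset M.cells :=
  Finset.univ.filter fun T => E ⊆ T.1 ∧ IsOutwardNormal T.1 E (𝔫.normal E)

open Classical in
/-- `T⁻(E)`, as a set with at most one element. -/
def minusCells (E : Finset (Vec d)) : Finset M.cells :=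
  Finset.univ.filter fun T => E ⊆ T.1 ∧ IsOutwardNormal T.1 E (-𝔫.normal E)

/-- The trace `w⁺` on the face `E` of a quantity given cell by cell. -/
def plusTrace (E : Finset (Vec d)) (w : M.cells → X) : X := ∑ T ∈ plusCells 𝔫 E, w T

/-- The trace `w⁻` on the face `E` of a quantity given cell by cell. -/
def minusTrace (E : Finset (Vec d)) (w : M.cells → X) : X := ∑ T ∈ minusCells 𝔫 E, w T

open Classical in
/-- The average `{w}` on the face `E`: `(w⁺ + w⁻) / 2` on interior faces, `w` on boundary faces. -/
def avg (E : Finset (Vec d)) (w : M.cells → X) : X :=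
  if E ∈ M.interiorFaces then (1 / 2 : ℝ) • (plusTrace 𝔫 E w + minusTrace 𝔫 E w)
  else plusTrace 𝔫 E w

open Classical in
/-- The jump `[w]` on the face `E`: `w⁺ - w⁻` on interior faces, `w` on boundary faces. -/
def jump (E : Finset (Vec d)) (w : M.cells → X) : X :=
  if E ∈ M.interiorFaces then plusTrace 𝔫 E w - minusTrace 𝔫 E w else plusTrace 𝔫 E w

end Traces

/-- The average of the vector field `u` on the face `E`, as a function of the point of `E`. -/
def avgOn (u : M.VDG) (E : Finset (Vec d)) (x : Vec d) : Vec d := avg 𝔫 E fun T => u T x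

/-- The jump of the vector field `u` on the face `E`, as a function of the point of `E`. -/
def jumpOn (u : M.VDG) (E : Finset (Vec d)) (x : Vec d) : Vec d := jump 𝔫 E fun T => u T x

end Mesh

section Faces

variable {d : ℕ}

/-- The `L²(E)`-projection onto constants, `|E|⁻¹ ∫_E w`, with respect to the surface measure (the
`(d - 1)`-dimensional Hausdorff measure in its Euclidean normalization). -/
def faceMean (E : Finset (Vec d)) (w : Vec d → Vec d) : Vec d := ⨍ x in hull E, w x ∂μHE[d - 1]

/-- The size `h_E` of the face `E`: its diameter. -/
def faceSize (E : Finset (Vec d)) : ℝ := Metric.diam (hull E)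

end Faces

section MeanLinear

variable {d : ℕ} {M : Mesh d}

theorem hull_measure_lt_top {E : Finset (Vec d)} (hE : E ∈ M.faces) :
    μHE[d - 1] (hull E) < ⊤ := by
  classical
  obtain ⟨T, hT, hET⟩ := Finset.mem_biUnion.1 hE
  obtain ⟨hsub, hcard⟩ := Finset.mem_powersetCard.1 hET
  rcases E.eq_empty_or_nonempty with rfl | ⟨p, hp⟩
  · simp [hull]
  have hd : E.card = (d - 1) + 1 := by
    have := Finset.card_pos.2 ⟨p, hp⟩
    omega
  have hind : AffineIndependent ℝ ((↑) : E → Vec d) :=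
    (M.indep T hT).mono (by exact_mod_cast hsub)
  set W : Submodule ℝ (Vec d) := vectorSpan ℝ (E : Set (Vec d)) with hW
  have hrank : Module.finrank ℝ W = d - 1 := by
    have h := hind.finrank_vectorSpan (n := d - 1) (by simpa using hd)
    have hr : Set.range ((↑) : E → Vec d) = (E : Set (Vec d)) := by simp
    rw [hr] at h
    exact h
  have hiso : Isometry fun w : W => (w : Vec d) + p :=
    (IsometryEquiv.addRight p).isometry.comp isometry_subtype_coe
  have hrange : hull E ⊆ Set.range fun w : W => (w : Vec d) + p := by
    intro x hx
    have h1 : x ∈ affineSpan ℝ (E : Set (Vec d)) := convexHull_subset_affineSpan _ hx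
    have h2 : x - p ∈ W := by
      have := AffineSubspace.vsub_mem_direction h1 (subset_affineSpan ℝ _ hp)
      rwa [direction_affineSpan] at this
    exact ⟨⟨x - p, h2⟩, by simp⟩
  have hcomp : IsCompact (hull E) := E.finite_toSet.isCompact_convexHull (𝕜 := ℝ)
  have hpre := hiso.euclideanHausdorffMeasure_preimage (d := d - 1) (hull E)
  rw [Set.inter_eq_left.2 hrange] at hpre
  have hK : IsCompact ((fun w : W => (w : Vec d) + p) ⁻¹' hull E) :=
    hiso.isClosedEmbedding.isCompact_preimage hcomp
  rw [← hpre, ← hrank, InnerProductSpace.euclideanHausdorffMeasure_eq_volume]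
  exact hK.measure_lt_top

theorem integrableOn_hull {E : Finset (Vec d)} (hE : E ∈ M.faces) {X : Type*}
    [NormedAddCommGroup X] {f : Vec d → X} (hf : Continuous f) :
    MeasureTheory.IntegrableOn f (hull E) μHE[d - 1] := by
  have hcomp : IsCompact (hull E) := E.finite_toSet.isCompact_convexHull (𝕜 := ℝ)
  have : MeasureTheory.IsFiniteMeasure ((μHE[d - 1] : MeasureTheory.Measure (Vec d)).restrict
      (hull E)) := ⟨by simpa using hull_measure_lt_top hE⟩
  have h := hf.continuousOn.integrableOn_compact (K := hull E)
    (μ := (μHE[d - 1] : MeasureTheory.Measure (Vec d)).restrict (hull E)) hcomp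
  rwa [MeasureTheory.IntegrableOn, MeasureTheory.Measure.restrict_restrict hcomp.measurableSet,
    Set.inter_self] at h

theorem faceMean_add {E : Finset (Vec d)} (hE : E ∈ M.faces) {f g : Vec d → Vec d}
    (hf : Continuous f) (hg : Continuous g) :
    faceMean E (fun x => f x + g x) = faceMean E f + faceMean E g := by
  simp only [faceMean, MeasureTheory.setAverage_eq]
  rw [MeasureTheory.integral_add (integrableOn_hull hE hf) (integrableOn_hull hE hg), smul_add]

theorem faceMean_smul (E : Finset (Vec d)) (c : ℝ) (f : Vec d → Vec d) :
    faceMean E (fun x => c • f x) = c • faceMean E f := by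
  simp only [faceMean, MeasureTheory.setAverage_eq, MeasureTheory.integral_smul, smul_comm c]

theorem faceMean_zero (E : Finset (Vec d)) : faceMean E (fun _ => 0) = 0 := by
  simp [faceMean]

namespace Mesh

variable (𝔫 : M.FaceNormals)

theorem avgOn_add (u w : M.VDG) (E : Finset (Vec d)) (x : Vec d) :
    avgOn 𝔫 (u + w) E x = avgOn 𝔫 u E x + avgOn 𝔫 w E x := by
  simp only [avgOn, avg, plusTrace, minusTrace, Pi.add_apply, AffineMap.coe_add,
    Finset.sum_add_distrib]
  split_ifs
  · module
  · rfl

theorem avgOn_smul (c : ℝ) (u : M.VDG) (E : Finset (Vec d)) (x : Vec d) :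
    avgOn 𝔫 (c • u) E x = c • avgOn 𝔫 u E x := by
  simp only [avgOn, avg, plusTrace, minusTrace, Pi.smul_apply, AffineMap.coe_smul,
    ← Finset.smul_sum]
  split_ifs
  · module
  · rfl

theorem avgOn_zero (E : Finset (Vec d)) (x : Vec d) : avgOn 𝔫 (0 : M.VDG) E x = 0 := by
  simp [avgOn, avg, plusTrace, minusTrace]

theorem continuous_avgOn (u : M.VDG) (E : Finset (Vec d)) : Continuous (avgOn 𝔫 u E) := by
  have h (T : M.cells) : Continuous fun x => u T x := (u T).continuous_of_finiteDimensional
  unfold avgOn avg plusTrace minusTrace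
  split_ifs <;> fun_prop

theorem jumpOn_add (u w : M.VDG) (E : Finset (Vec d)) (x : Vec d) :
    jumpOn 𝔫 (u + w) E x = jumpOn 𝔫 u E x + jumpOn 𝔫 w E x := by
  simp only [jumpOn, jump, plusTrace, minusTrace, Pi.add_apply, AffineMap.coe_add,
    Finset.sum_add_distrib]
  split_ifs
  · module
  · rfl

theorem jumpOn_smul (c : ℝ) (u : M.VDG) (E : Finset (Vec d)) (x : Vec d) :
    jumpOn 𝔫 (c • u) E x = c • jumpOn 𝔫 u E x := by
  simp only [jumpOn, jump, plusTrace, minusTrace, Pi.smul_apply, AffineMap.coe_smul,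
    ← Finset.smul_sum]
  split_ifs
  · module
  · rfl

theorem jumpOn_zero (E : Finset (Vec d)) (x : Vec d) : jumpOn 𝔫 (0 : M.VDG) E x = 0 := by
  simp [jumpOn, jump, plusTrace, minusTrace]

theorem continuous_jumpOn (u : M.VDG) (E : Finset (Vec d)) : Continuous (jumpOn 𝔫 u E) := by
  have h (T : M.cells) : Continuous fun x => u T x := (u T).continuous_of_finiteDimensional
  unfold jumpOn jump plusTrace minusTrace
  split_ifs <;> fun_prop

/-- The vector valued Crouzeix-Raviart space: the jump has zero mean on every interior face and on
every Dirichlet face. -/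
def VCR (D : Finset (Finset (Vec d))) : Submodule ℝ M.VDG where
  carrier := {v | ∀ E ∈ M.faces, E ∈ M.interiorOrDirichlet D → faceMean E (jumpOn 𝔫 v E) = 0}
  add_mem' {u w} hu hw E hE hED := by
    have h : jumpOn 𝔫 (u + w) E = fun x => jumpOn 𝔫 u E x + jumpOn 𝔫 w E x :=
      funext (jumpOn_add 𝔫 u w E)
    rw [h, faceMean_add hE (continuous_jumpOn 𝔫 u E) (continuous_jumpOn 𝔫 w E), hu E hE hED,
      hw E hE hED, add_zero]
  zero_mem' E _ _ := by
    have h : jumpOn 𝔫 (0 : M.VDG) E = fun _ => 0 := funext (jumpOn_zero 𝔫 E)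
    rw [h, faceMean_zero]
  smul_mem' c u hu E hE hED := by
    have h : jumpOn 𝔫 (c • u) E = fun x => c • jumpOn 𝔫 u E x := funext (jumpOn_smul 𝔫 c u E)
    rw [h, faceMean_smul, hu E hE hED, smul_zero]

/-- The complementary space `𝒵`: the average has zero mean on every interior face and on every
Neumann face. -/
def Zspace (D : Finset (Finset (Vec d))) : Submodule ℝ M.VDG where
  carrier := {z | ∀ E ∈ M.faces, E ∈ M.interiorOrNeumann D → faceMean E (avgOn 𝔫 z E) = 0}
  add_mem' {u w} hu hw E hE hEN := by
    have h : avgOn 𝔫 (u + w) E = fun x => avgOn 𝔫 u E x + avgOn 𝔫 w E x :=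
      funext (avgOn_add 𝔫 u w E)
    rw [h, faceMean_add hE (continuous_avgOn 𝔫 u E) (continuous_avgOn 𝔫 w E), hu E hE hEN,
      hw E hE hEN, add_zero]
  zero_mem' E _ _ := by
    have h : avgOn 𝔫 (0 : M.VDG) E = fun _ => 0 := funext (avgOn_zero 𝔫 E)
    rw [h, faceMean_zero]
  smul_mem' c u hu E hE hEN := by
    have h : avgOn 𝔫 (c • u) E = fun x => c • avgOn 𝔫 u E x := funext (avgOn_smul 𝔫 c u E)
    rw [h, faceMean_smul, hu E hE hEN, smul_zero]

end Mesh

end MeanLinear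

/-- The gradient of an affine vector field, `(∇u)ᵢⱼ = ∂uᵢ/∂xⱼ`. -/
def gradient {d : ℕ} (u : Vec d →ᵃ[ℝ] Vec d) : Matrix (Fin d) (Fin d) ℝ :=
  Matrix.of fun i j => u.linear (EuclideanSpace.single j 1) i

/-- The symmetric gradient `ε(u) = (∇u + (∇u)ᵀ) / 2`. -/
def symGrad {d : ℕ} (u : Vec d →ᵃ[ℝ] Vec d) : Matrix (Fin d) (Fin d) ℝ :=
  (1 / 2 : ℝ) • (gradient u + (gradient u).transpose)

/-- The elasticity tensor `𝒞 A = 2 μ A + λ tr(A) I`. -/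
def elasticity {d : ℕ} (lam mu : ℝ) (A : Matrix (Fin d) (Fin d) ℝ) : Matrix (Fin d) (Fin d) ℝ :=
  (2 * mu) • A + (lam * A.trace) • (1 : Matrix (Fin d) (Fin d) ℝ)

/-- The Frobenius scalar product of matrices. -/
def frobenius {d : ℕ} (A B : Matrix (Fin d) (Fin d) ℝ) : ℝ := ∑ i, ∑ j, A i j * B i j

namespace Mesh

variable {d : ℕ} {M : Mesh d} (𝔫 : M.FaceNormals) (D : Finset (Finset (Vec d)))
  (α₀ α₁ lam mu θ : ℝ)

/-- The average `{(𝒞 ε(u)) n}` of the normal stress on the face `E` (constant on `E`). -/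
def avgNormalStress (u : M.VDG) (E : Finset (Vec d)) : Vec d :=
  avg 𝔫 E fun T => WithLp.toLp 2
    ((elasticity lam mu (symGrad (u T))).mulVec (WithLp.ofLp (𝔫.normal E)))

/-- `(𝒞 ε(u) : ε(w))` over all cells. -/
def volumeTerm (u w : M.VDG) : ℝ :=
  ∑ T : M.cells, ∫ _x in hull T.1, frobenius (elasticity lam mu (symGrad (u T))) (symGrad (w T))

/-- `({(𝒞 ε(u)) n}, [w])` over the interior and the Dirichlet faces. -/
def consistencyTerm (u w : M.VDG) : ℝ :=
  ∑ E ∈ M.interiorOrDirichlet D,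
    ∫ x in hull E, inner ℝ (avgNormalStress 𝔫 lam mu u E) (jumpOn 𝔫 w E x) ∂μHE[d - 1]

/-- The penalty term with reduced integration (projected jumps), `β₀ = d λ + 2 μ`. -/
def penalty₀ (u w : M.VDG) : ℝ :=
  α₀ * (d * lam + 2 * mu) * ∑ E ∈ M.interiorOrDirichlet D,
    ∫ x in hull E, inner ℝ ((faceSize E)⁻¹ • jumpOn 𝔫 u E x) (faceMean E (jumpOn 𝔫 w E))
      ∂μHE[d - 1]

/-- The penalty term with full jumps, `β₁ = 2 μ`. -/
def penalty₁ (u w : M.VDG) : ℝ :=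
  α₁ * (2 * mu) * ∑ E ∈ M.interiorOrDirichlet D,
    ∫ x in hull E, inner ℝ ((faceSize E)⁻¹ • jumpOn 𝔫 u E x) (jumpOn 𝔫 w E x) ∂μHE[d - 1]

/-- The interior penalty (IP-1) bilinear form `𝒜`; it is symmetric for `θ = -1`. -/
def formA (u w : M.VDG) : ℝ :=
  volumeTerm lam mu u w - consistencyTerm 𝔫 D lam mu u w + θ * consistencyTerm 𝔫 D lam mu w u
    + (penalty₀ 𝔫 D α₀ lam mu u w + penalty₁ 𝔫 D α₁ mu u w)

/-- The form `𝒜` in the variables of the splitting: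
`𝒜((z, v), (ζ, φ)) = 𝒜(z + v, ζ + φ)`. -/
def splitFormA (p q : Zspace 𝔫 D × VCR 𝔫 D) : ℝ :=
  formA 𝔫 D α₀ α₁ lam mu θ (p.1.1 + p.2.1) (q.1.1 + q.2.1)

/-- The block diagonal form `ℬ((z, v), (ζ, φ)) = 𝒜(z, ζ) + 𝒜(v, φ)`. -/
def blockFormB (p q : Zspace 𝔫 D × VCR 𝔫 D) : ℝ :=
  formA 𝔫 D α₀ α₁ lam mu θ p.1.1 q.1.1 + formA 𝔫 D α₀ α₁ lam mu θ p.2.1 q.2.1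

end Mesh

end DGElasticity

end

/-! The splitting makes almost every term of `𝒜` vanish between the two summands. The mean of an
affine field over a face is its value at the barycentre of the face (`faceMean_affineMap`), and the
values at the face barycentres of a cell determine an affine field and can be prescribed freely
(`affineMap_ext_ctr`, `crInterp_apply_ctr`). Membership in `VCR` or `Zspace` is therefore a
condition on these values, face by face, and solving for them from jumps and averages gives the
direct sum (`isCompl_VCR_Zspace`).

Normal stresses are constant on faces, so the consistency term and the reduced penalty vanish when
tested with a field `v` of mean-free jumps. Green's formula on each cell, together with the
vanishing averages of `z`, turns the elastic energy product of any `u` with `z` into the consistency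
term of `u` and `z` (`volumeTerm_eq_consistencyTerm`). With the symmetric sign these two cancel, and
`𝒜(z, v)` is the full penalty term alone (`formA_Zspace_VCR`). Since `[v]` is mean free, only the
mean-free part of `[z]` contributes; hence `𝒜(z, v)² ≤ q 𝒜(v, v)`, where `q` is `α₁ β₁` times the
weighted norm squared of that part (`sq_formA_Zspace_VCR_le`).

It remains to see that `q` is at most a fixed fraction of `𝒜(z, z)`. Let `S` be the weighted sum of
the squared mean jumps and `C = d (d + 1) σ`. On `𝒵` the barycentre values are controlled by the
mean jumps, so the broken gradient satisfies `‖∇z‖² ≤ C S` (`gradEnergy_le`); a trace estimate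
bounds the mean-free jumps by `2 C ‖∇z‖²` (`oscJumpEnergy_le`). Together with `β₁ ≤ β₀` this gives
`q ≤ K β₀ S`, `K = 2 α₁ C²`. On the other hand `𝒜(z, z)` is the two penalties minus the elastic
energy, and for `α₀ ≥ 2 C` half of the reduced penalty absorbs this energy: `𝒜(z, z) ≥ (α₀ / 2) β₀ S
+ q` (`formA_Zspace_ge`). So `γ² = K / (K + α₀ / 2)` works, independently of `λ`, `μ` and the mesh.
Strains are only bounded from above by gradients, so no Korn inequality enters. -/

noncomputable section

namespace DGElasticity

open MeasureTheory

/-! ### Mean value of an affine function over a full-dimensional simplex. -/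

section SimplexMean

variable {V ι : Type*} [NormedAddCommGroup V] [InnerProductSpace ℝ V]

/-- The affine involution that exchanges the vertices `b i` and `b j` of a simplex. -/
def vertexSwap (b : AffineBasis ι ℝ V) (i j : ι) : V →ᵃ[ℝ] V :=
  AffineMap.id ℝ V + (AffineMap.lineMap (0 : V) (b j - b i)).comp (b.coord i - b.coord j)

theorem vertexSwap_apply (b : AffineBasis ι ℝ V) (i j : ι) (x : V) :
    vertexSwap b i j x = x + (b.coord i x - b.coord j x) • (b j - b i) := by
  simp [vertexSwap, AffineMap.lineMap_apply]

theorem coord_add_smul_sub (b : AffineBasis ι ℝ V)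
    (k : ι) (x : V) (c : ℝ) (i j : ι) :
    b.coord k (x + c • (b j - b i)) = b.coord k x + c * (b.coord k (b j) - b.coord k (b i)) := by
  have h1 : (b.coord k).linear (b j - b i) = b.coord k (b j) - b.coord k (b i) :=
    (b.coord k).linearMap_vsub (b j) (b i)
  have h2 := (b.coord k).map_vadd x (c • (b j - b i))
  rw [vadd_eq_add, add_comm] at h2
  rw [h2, map_smul, h1, vadd_eq_add, smul_eq_mul, add_comm]

/-- The direction `b j - b i` has coordinates `-1` at `i`, `1` at `j` and `0` elsewhere, so a shift
by the difference of the two coordinates exchanges them. -/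
theorem coord_vertexSwap [DecidableEq ι] (b : AffineBasis ι ℝ V) {i j : ι} (hij : i ≠ j) (k : ι)
    (x : V) : b.coord k (vertexSwap b i j x) = b.coord (Equiv.swap i j k) x := by
  rw [vertexSwap_apply, coord_add_smul_sub, b.coord_apply, b.coord_apply]
  rcases eq_or_ne k i with rfl | hki
  · simp [hij]
  rcases eq_or_ne k j with rfl | hkj
  · simp [hki]
  · simp [hki, hkj, Equiv.swap_apply_of_ne_of_ne hki hkj]

theorem vertexSwap_involutive [Finite ι] (b : AffineBasis ι ℝ V) {i j : ι} (hij : i ≠ j) :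
    Function.Involutive (vertexSwap b i j) := by
  classical
  intro x
  refine b.ext_elem fun k => ?_
  rw [coord_vertexSwap b hij, coord_vertexSwap b hij, Equiv.swap_apply_self]

variable [FiniteDimensional ℝ V] [MeasurableSpace V] [BorelSpace V]

/-- The linear part of an affine involution squares to the identity, so its determinant is `1` or
`-1`; the translation part does not affect the measure. -/
theorem measurePreserving_vertexSwap [Finite ι] (b : AffineBasis ι ℝ V) {i j : ι} (hij : i ≠ j) :
    MeasurePreserving (vertexSwap b i j) (volume : Measure V) volume := by
  have hinv : (vertexSwap b i j).linear ∘ₗ (vertexSwap b i j).linear = LinearMap.id := by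
    rw [← AffineMap.comp_linear]
    have : (vertexSwap b i j).comp (vertexSwap b i j) = AffineMap.id ℝ V := by
      ext x
      exact vertexSwap_involutive b hij x
    rw [this, AffineMap.id_linear]
  have hdet : (vertexSwap b i j).linear.det * (vertexSwap b i j).linear.det = 1 := by
    rw [← LinearMap.det_comp, hinv, LinearMap.det_id]
  have hne : (vertexSwap b i j).linear.det ≠ 0 := left_ne_zero_of_mul_eq_one hdet
  have habs : |(vertexSwap b i j).linear.det| = 1 := by
    rcases mul_self_eq_one_iff.1 hdet with h | h <;> simp [h]
  have hlin : MeasurePreserving (vertexSwap b i j).linear (volume : Measure V) volume := by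
    refine ⟨(LinearMap.continuous_of_finiteDimensional _).measurable, ?_⟩
    rw [Measure.map_linearMap_addHaar_eq_smul_addHaar _ hne, abs_inv, habs]
    simp
  have hadd := measurePreserving_add_right (volume : Measure V) (vertexSwap b i j 0)
  have hcomp := hadd.comp hlin
  convert hcomp using 1
  ext x
  simpa using (vertexSwap b i j).decomp' ▸ congrFun (vertexSwap b i j).decomp x

/-- By symmetry: the vertex swaps preserve both the volume and the simplex, so all barycentric
coordinates have the same integral. As they sum to `1`, each integral is the volume divided by the
number of vertices, and `f` is a combination of the coordinates. -/
theorem integral_affine_convexHull [Fintype ι] (b : AffineBasis ι ℝ V) (f : V →ᵃ[ℝ] ℝ) :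
    ∫ x in convexHull ℝ (Set.range b), f x =
      volume.real (convexHull ℝ (Set.range b)) * ((Fintype.card ι : ℝ)⁻¹ * ∑ i, f (b i)) := by
  classical
  set K := convexHull ℝ (Set.range b) with hK
  have hcomp : IsCompact K := (Set.finite_range b).isCompact_convexHull (𝕜 := ℝ)
  have hint (i : ι) : IntegrableOn (b.coord i) K :=
    (b.coord i).continuous_of_finiteDimensional.continuousOn.integrableOn_compact hcomp
  have heq (i j : ι) : ∫ x in K, b.coord i x = ∫ x in K, b.coord j x := by
    rcases eq_or_ne i j with rfl | hij
    · rfl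
    have hmp := measurePreserving_vertexSwap b hij
    have hpre : vertexSwap b i j ⁻¹' K = K := by
      ext x
      simp only [hK, b.convexHull_eq_nonneg_coord, Set.mem_preimage, Set.mem_ofPred_eq,
        coord_vertexSwap b hij]
      exact ⟨fun h k => by simpa using h (Equiv.swap i j k), fun h k => h _⟩
    let e : V ≃ᵐ V :=
      { toEquiv := (vertexSwap_involutive b hij).toPerm
        measurable_toFun := hmp.measurable
        measurable_invFun := hmp.measurable }
    have h := hmp.setIntegral_preimage_emb e.measurableEmbedding (b.coord i) K
    rw [hpre] at h
    rw [← h]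
    refine integral_congr_ae (ae_of_all _ fun x => ?_)
    simp [coord_vertexSwap b hij]
  obtain ⟨i₀⟩ := b.nonempty
  have hcard : (Fintype.card ι : ℝ) ≠ 0 := by
    have : 0 < Fintype.card ι := Fintype.card_pos_iff.2 ⟨i₀⟩
    positivity
  have hsum : (Fintype.card ι : ℝ) * ∫ x in K, b.coord i₀ x = volume.real K := by
    calc (Fintype.card ι : ℝ) * ∫ x in K, b.coord i₀ x = ∑ i, ∫ x in K, b.coord i x := by
          simp [fun i => heq i i₀]
      _ = ∫ x in K, ∑ i, b.coord i x := (integral_finsetSum _ fun i _ => hint i).symm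
      _ = volume.real K := by simp [b.sum_coord_apply_eq_one]
  have hf (x : V) : f x = ∑ i, b.coord i x * f (b i) := by
    conv_lhs => rw [← b.affineCombination_coord_eq_self x]
    rw [Finset.map_affineCombination _ _ _ (b.sum_coord_apply_eq_one x),
      Finset.affineCombination_eq_linear_combination _ _ _ (b.sum_coord_apply_eq_one x)]
    simp
  calc ∫ x in K, f x = ∫ x in K, ∑ i, b.coord i x * f (b i) := by simp_rw [← hf]
    _ = ∑ i, (∫ x in K, b.coord i x) * f (b i) := by
        rw [integral_finsetSum _ fun i _ => (hint i).mul_const _]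
        simp [integral_mul_const]
    _ = _ := by
        simp_rw [fun i => heq i i₀, ← Finset.mul_sum, ← hsum]
        field_simp

end SimplexMean

/-! ### Surface measure of a face and volume of a cone over it. -/

section

variable {d : ℕ}

/-- The barycentre of the vertices. -/
def ctr (E : Finset (Vec d)) : Vec d := (E.card : ℝ)⁻¹ • ∑ q ∈ E, q

/-- The surface measure of a face. -/
def area (E : Finset (Vec d)) : ℝ := (μHE[d - 1] : Measure (Vec d)).real (hull E)

theorem affineMap_ctr {X : Type*} [AddCommGroup X] [Module ℝ X] (f : Vec d →ᵃ[ℝ] X)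
    {E : Finset (Vec d)} (hE : E.Nonempty) : f (ctr E) = (E.card : ℝ)⁻¹ • ∑ q ∈ E, f q := by
  have hc : (E.card : ℝ) ≠ 0 := by exact_mod_cast hE.card_pos.ne'
  have h (x : Vec d) : f x = f.linear x + f 0 := congrFun f.decomp x
  rw [h, ctr, map_smul, map_sum]
  rw [Finset.sum_congr rfl fun q _ => h q, Finset.sum_add_distrib, Finset.sum_const, smul_add,
    ← Nat.cast_smul_eq_nsmul ℝ, smul_smul, inv_mul_cancel₀ hc, one_smul]

/-- The face is the isometric image, under a translated inclusion `g`, of a full-dimensional simplex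
in its direction space `W`. As `W` has dimension `d - 1`, the normalized Hausdorff measure on it is
Lebesgue measure, and the formula for full-dimensional simplices applies. -/
theorem setIntegral_affineMap_hull {E : Finset (Vec d)} (hE : E.Nonempty) (hd : E.card = d)
    (hind : AffineIndependent ℝ ((↑) : E → Vec d)) (f : Vec d →ᵃ[ℝ] ℝ) :
    0 < area E ∧ ∫ x in hull E, f x ∂μHE[d - 1] = area E * f (ctr E) := by
  classical
  obtain ⟨p, hp⟩ := hE
  have hpos : 0 < d := hd ▸ Finset.card_pos.2 ⟨p, hp⟩
  set W : Submodule ℝ (Vec d) := vectorSpan ℝ (E : Set (Vec d)) with hW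
  have hr : Set.range ((↑) : E → Vec d) = (E : Set (Vec d)) := by simp
  have hrank : Module.finrank ℝ W = d - 1 := by
    have h := hind.finrank_vectorSpan (n := d - 1) (by simp; omega)
    rwa [hr] at h
  have hmem (q : E) : (q : Vec d) - p ∈ W :=
    vsub_mem_vectorSpan ℝ q.2 hp
  let g : W →ᵃ[ℝ] Vec d := W.subtype.toAffineMap + AffineMap.const ℝ W p
  have hg (w : W) : g w = (w : Vec d) + p := rfl
  have hginj : Function.Injective g := fun a b h => by simpa [hg] using h
  let pts : E → W := fun q => ⟨q - p, hmem q⟩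
  have hgp (q : E) : g (pts q) = q := by simp [hg, pts]
  have hindW : AffineIndependent ℝ pts := by
    refine AffineIndependent.of_comp g ?_
    convert hind using 1
    exact funext hgp
  have htop : affineSpan ℝ (Set.range pts) = ⊤ := by
    rw [hindW.affineSpan_eq_top_iff_card_eq_finrank_add_one, hrank]
    simp; omega
  let b : AffineBasis E ℝ W := ⟨pts, hindW, htop⟩
  have hb (q : E) : b q = pts q := rfl
  have hrangeb : Set.range b = Set.range pts := rfl
  have himg : g '' convexHull ℝ (Set.range b) = hull E := by
    rw [g.image_convexHull, hrangeb, ← Set.range_comp]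
    congr 1
    rw [← hr]
    exact congrArg Set.range (funext hgp)
  have hiso : Isometry g := (IsometryEquiv.addRight p).isometry.comp isometry_subtype_coe
  have hpre : g ⁻¹' hull E = convexHull ℝ (Set.range b) := by
    rw [← himg, Set.preimage_image_eq _ hginj]
  have hsub : hull E ⊆ Set.range g := himg ▸ Set.image_subset_range _ _
  have hcomp : IsCompact (hull E) := E.finite_toSet.isCompact_convexHull (𝕜 := ℝ)
  have hvol : (μHE[d - 1] : Measure W) = volume := by
    rw [← hrank, InnerProductSpace.euclideanHausdorffMeasure_eq_volume]
  have harea : area E = volume.real (convexHull ℝ (Set.range b)) := by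
    have := hiso.euclideanHausdorffMeasure_image (d := d - 1) (convexHull ℝ (Set.range b))
    rw [himg, hvol] at this
    rw [area, measureReal_def, this, measureReal_def]
  have hmap : (volume : Measure W).map g =
      (μHE[d - 1] : Measure (Vec d)).restrict (Set.range g) := by
    rw [← hiso.map_euclideanHausdorffMeasure, hvol]
  constructor
  · rw [harea, measureReal_def]
    have hK : IsCompact (convexHull ℝ (Set.range b)) :=
      (Set.finite_range b).isCompact_convexHull (𝕜 := ℝ)
    refine ENNReal.toReal_pos ?_ hK.measure_lt_top.ne
    refine ((isOpen_interior.measure_pos _ ?_).trans_le (measure_mono interior_subset)).ne'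
    exact interior_convexHull_nonempty_iff_affineSpan_eq_top.2 htop
  have h1 := integral_affine_convexHull b (f.comp g)
  have hemb : MeasurableEmbedding g := hiso.isClosedEmbedding.measurableEmbedding
  have h2 : ∫ x in hull E, f x ∂μHE[d - 1] = ∫ w in convexHull ℝ (Set.range b), f (g w) := by
    rw [← hpre, ← hemb.setIntegral_map, hmap, Measure.restrict_restrict hcomp.measurableSet,
      Set.inter_eq_left.2 hsub]
  rw [h2, harea, affineMap_ctr f ⟨p, hp⟩]
  have h3 : ∑ i, (f.comp g) (b i) = ∑ q ∈ E, f q := by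
    simp only [AffineMap.comp_apply, hb, hgp]
    exact Finset.sum_coe_sort E f
  rw [h3, Fintype.card_coe] at h1
  exact h1

theorem hull_cone {E : Finset (Vec d)} (hE : E.Nonempty) {p : Vec d} {y : Vec d} :
    y ∈ convexHull ℝ (insert p (E : Set (Vec d))) ↔
      ∃ t ∈ Set.Icc (0 : ℝ) 1, ∃ x ∈ hull E, y = p + t • (x - p) := by
  rw [convexHull_insert (by exact_mod_cast hE), mem_convexJoin]
  simp only [Set.mem_singleton_iff, exists_eq_left, segment_eq_image', Set.mem_image]
  exact ⟨fun ⟨x, hx, t, ht, h⟩ => ⟨t, ht, x, hx, h.symm⟩,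
    fun ⟨t, ht, x, hx, h⟩ => ⟨x, hx, t, ht, h.symm⟩⟩

/-- The volume of a cone over a face. -/
theorem volume_cone (hd : 0 < d) {E : Finset (Vec d)} (hE : E.Nonempty) {p n : Vec d} {h : ℝ}
    (hn : ‖n‖ = 1) (hh : 0 < h) (hnE : ∀ x ∈ E, inner ℝ n (x - p) = h) :
    (volume : Measure (Vec d)).real (convexHull ℝ (insert p (E : Set (Vec d)))) * d =
      area E * h := by
  set K := convexHull ℝ (insert p (E : Set (Vec d))) with hK
  have hn0 : n ≠ 0 := by rintro rfl; simp at hn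
  have hnE' : ∀ x ∈ hull E, inner ℝ n (x - p) = h := by
    intro x hx
    have hc : Convex ℝ {x : Vec d | inner ℝ n (x - p) = h} := by
      have : {x : Vec d | inner ℝ n (x - p) = h} = {x : Vec d | inner ℝ n x = h + inner ℝ n p} := by
        ext x
        simp [inner_sub_right, sub_eq_iff_eq_add]
      rw [this]
      exact convex_hyperplane (innerₛₗ ℝ n).isLinear _
    exact convexHull_min (fun x hx => hnE x hx) hc hx
  have hKcomp : IsCompact K := (E.finite_toSet.insert p).isCompact_convexHull (𝕜 := ℝ)
  -- Cavalieri's principle in the direction `n`: the slice at height `t` is the base scaled by `t /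
  -- h` about the apex. At `t = 0` the homothety degenerates, but a single height is negligible.
  have hslice (t : ℝ) (ht : t ≠ 0) :
      (μHE[d - 1] : Measure (Vec d)) (K ∩ AffineSubspace.mk' (t • n +ᵥ p) (ℝ ∙ n)ᗮ) =
        (Set.Ioc 0 h).indicator
          (fun t => ENNReal.ofReal ((t / h) ^ (d - 1)) * μHE[d - 1] (hull E)) t := by
    have hmem (y : Vec d) : y ∈ AffineSubspace.mk' (t • n +ᵥ p) (ℝ ∙ n)ᗮ ↔
        inner ℝ n (y - p) = t := by
      rw [AffineSubspace.mem_mk', Submodule.mem_orthogonal_singleton_iff_inner_right, vadd_eq_add,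
        vsub_eq_sub, add_comm, ← sub_sub, inner_sub_right, inner_smul_right,
        real_inner_self_eq_norm_sq, hn, one_pow, mul_one, sub_eq_zero]
    by_cases hth : t ∈ Set.Ioc 0 h
    · rw [Set.indicator_of_mem hth]
      have himg : K ∩ AffineSubspace.mk' (t • n +ᵥ p) (ℝ ∙ n)ᗮ =
          AffineMap.homothety p (t / h) '' hull E := by
        ext y
        rw [Set.mem_inter_iff, SetLike.mem_coe, hmem]
        simp only [Set.mem_image,
          AffineMap.homothety_apply, vsub_eq_sub, vadd_eq_add, hK, hull_cone hE]
        constructor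
        · rintro ⟨⟨s, hs, x, hx, rfl⟩, hy⟩
          refine ⟨x, hx, ?_⟩
          rw [add_sub_cancel_left, inner_smul_right, hnE' x hx] at hy
          rw [← hy, mul_div_cancel_right₀ _ hh.ne', add_comm]
        · rintro ⟨x, hx, rfl⟩
          refine ⟨⟨t / h, ⟨div_nonneg hth.1.le hh.le, (div_le_one hh).2 hth.2⟩, x, hx,
            add_comm _ _⟩, ?_⟩
          rw [add_sub_cancel_right, inner_smul_right, hnE' x hx, div_mul_cancel₀ _ hh.ne']
      rw [himg, euclideanHausdorffMeasure_homothety_image _ _ (div_ne_zero ht hh.ne'),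
        ENNReal.smul_def, smul_eq_mul]
      congr 1
      rw [ENNReal.ofReal, ENNReal.coe_inj, ← NNReal.coe_inj, NNReal.coe_pow, coe_nnnorm,
        Real.norm_of_nonneg (div_nonneg hth.1.le hh.le), Real.coe_toNNReal]
      exact pow_nonneg (div_nonneg hth.1.le hh.le) _
    · rw [Set.indicator_of_notMem hth]
      refine (congrArg _ (Set.eq_empty_iff_forall_notMem.2 ?_)).trans measure_empty
      rintro y ⟨hy, hy'⟩
      rw [SetLike.mem_coe, hmem] at hy'
      obtain ⟨s, hs, x, hx, rfl⟩ := (hull_cone hE).1 hy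
      rw [add_sub_cancel_left, inner_smul_right, hnE' x hx] at hy'
      refine hth ⟨lt_of_le_of_ne (hy' ▸ mul_nonneg hs.1 hh.le) ht.symm, ?_⟩
      rw [← hy']
      exact mul_le_of_le_one_left hh.le hs.2
  have hmain := EuclideanGeometry.euclideanHausdorffMeasure_eq_lintegral p hn0
    hKcomp.measurableSet
  rw [InnerProductSpace.euclideanHausdorffMeasure_eq_volume] at hmain
  have hfin : Module.finrank ℝ (Vec d) = d := by simp
  have hae : ∀ᵐ t : ℝ, t ≠ 0 := by
    simp [ae_iff]
  rw [hfin, lintegral_congr_ae (hae.mono hslice), lintegral_indicator measurableSet_Ioc,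
    lintegral_mul_const _ (by fun_prop), ← ofReal_integral_eq_lintegral_ofReal] at hmain
  · rw [measureReal_def, hmain, ← ofReal_norm, hn, ENNReal.ofReal_one, one_mul,
      ENNReal.toReal_mul, ENNReal.toReal_ofReal, area, measureReal_def,
      ← intervalIntegral.integral_of_le hh.le]
    · have : ∫ t in (0:ℝ)..h, (t / h) ^ (d - 1) = h / d := by
        simp_rw [div_pow]
        rw [intervalIntegral.integral_div, integral_pow]
        obtain ⟨k, rfl⟩ : ∃ k, d = k + 1 := ⟨d - 1, by omega⟩
        simp
        field_simp
        rw [pow_succ]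
      rw [this]
      field_simp
    · exact setIntegral_nonneg measurableSet_Ioc fun t ht => pow_nonneg (div_nonneg ht.1.le hh.le) _
  · exact (Continuous.integrableOn_Icc (by fun_prop)).mono_set Set.Ioc_subset_Icc_self
  · exact (ae_restrict_mem measurableSet_Ioc).mono fun t ht =>
      pow_nonneg (div_nonneg ht.1.le hh.le) _

end

/-! ### Cells, their faces, and interpolation at the face barycentres. -/

namespace Mesh

variable {d : ℕ} {M : Mesh d}

/-- The vertices of a cell as an affine basis. -/
def basis (T : M.cells) : AffineBasis T.1 ℝ (Vec d) :=
  ⟨(↑), M.indep T.1 T.2, by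
    rw [(M.indep T.1 T.2).affineSpan_eq_top_iff_card_eq_finrank_add_one]
    simp [M.card_eq T.1 T.2]⟩

@[simp] theorem basis_apply (T : M.cells) (p : T.1) : basis T p = p := rfl

theorem range_basis (T : M.cells) : Set.range (basis T) = (T.1 : Set (Vec d)) := by
  ext x
  simp

theorem mem_hull_iff (T : M.cells) (x : Vec d) : x ∈ hull T.1 ↔ ∀ p, 0 ≤ (basis T).coord p x := by
  have h := (basis T).convexHull_eq_nonneg_coord
  rw [range_basis] at h
  rw [hull, h, Set.mem_ofPred_eq]

open Classical in
/-- The face of a cell opposite to a vertex. -/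
def opp (T : M.cells) (p : T.1) : Finset (Vec d) := T.1.erase p

theorem mem_opp {T : M.cells} {p : T.1} {x : Vec d} : x ∈ opp T p ↔ x ≠ p ∧ x ∈ T.1 := by
  simp [opp]

theorem opp_subset (T : M.cells) (p : T.1) : opp T p ⊆ T.1 := fun _ hx => (mem_opp.1 hx).2

theorem card_opp (T : M.cells) (p : T.1) : (opp T p).card = d := by
  classical
  rw [opp, Finset.card_erase_of_mem p.2, M.card_eq T.1 T.2, Nat.add_sub_cancel]

theorem opp_injective (T : M.cells) : Function.Injective (opp T) := by
  intro p q h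
  by_contra hne
  have : (p : Vec d) ∈ opp T q := mem_opp.2 ⟨fun h' => hne (Subtype.ext h'), p.2⟩
  rw [← h] at this
  exact (mem_opp.1 this).1 rfl

theorem exists_opp_eq (T : M.cells) {E : Finset (Vec d)} (hE : E ⊆ T.1) (hc : E.card = d) :
    ∃ p, opp T p = E := by
  classical
  have h1 : (T.1 \ E).card = 1 := by
    rw [Finset.card_sdiff_of_subset hE, M.card_eq T.1 T.2, hc, Nat.add_sub_cancel_left]
  obtain ⟨p, hp⟩ := Finset.card_eq_one.1 h1
  have hpT : p ∈ T.1 \ E := hp ▸ Finset.mem_singleton_self p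
  refine ⟨⟨p, (Finset.mem_sdiff.1 hpT).1⟩, ?_⟩
  rw [opp, Finset.erase_eq, ← hp, Finset.sdiff_sdiff_eq_self hE]

theorem mem_faces {E : Finset (Vec d)} : E ∈ M.faces ↔ ∃ T : M.cells, E ⊆ T.1 ∧ E.card = d := by
  simp only [faces, Finset.mem_biUnion, Finset.mem_powersetCard, Subtype.exists]
  exact exists_congr fun T => ⟨fun ⟨h, h'⟩ => ⟨h, h'⟩, fun ⟨h, h'⟩ => ⟨h, h'⟩⟩

theorem opp_mem_faces (T : M.cells) (p : T.1) : opp T p ∈ M.faces :=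
  mem_faces.2 ⟨T, opp_subset T p, card_opp T p⟩

theorem card_of_mem_faces {E : Finset (Vec d)} (hE : E ∈ M.faces) : E.card = d :=
  (mem_faces.1 hE).choose_spec.2

theorem nonempty_of_mem_faces (hd : 0 < d) {E : Finset (Vec d)} (hE : E ∈ M.faces) : E.Nonempty :=
  Finset.card_pos.1 ((card_of_mem_faces hE).symm ▸ hd)

theorem affineIndependent_of_mem_faces {E : Finset (Vec d)} (hE : E ∈ M.faces) :
    AffineIndependent ℝ ((↑) : E → Vec d) := by
  obtain ⟨T, hT, -⟩ := mem_faces.1 hE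
  exact (M.indep T.1 T.2).mono (by exact_mod_cast hT)

theorem area_pos (hd : 0 < d) {E : Finset (Vec d)} (hE : E ∈ M.faces) : 0 < area E :=
  (setIntegral_affineMap_hull (nonempty_of_mem_faces hd hE) (card_of_mem_faces hE)
    (affineIndependent_of_mem_faces hE) 0).1

theorem setIntegral_inner_affineMap (hd : 0 < d) {E : Finset (Vec d)} (hE : E ∈ M.faces)
    (c : Vec d) (f : Vec d →ᵃ[ℝ] Vec d) :
    ∫ x in hull E, inner ℝ c (f x) ∂μHE[d - 1] = area E * inner ℝ c (f (ctr E)) :=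
  (setIntegral_affineMap_hull (nonempty_of_mem_faces hd hE) (card_of_mem_faces hE)
    (affineIndependent_of_mem_faces hE) ((innerₛₗ ℝ c).toAffineMap.comp f)).2

/-- The mean of an affine field on a face is its value at the barycentre. -/
theorem faceMean_affineMap (hd : 0 < d) {E : Finset (Vec d)} (hE : E ∈ M.faces)
    (f : Vec d →ᵃ[ℝ] Vec d) : faceMean E f = f (ctr E) := by
  have hint := integrableOn_hull hE (f.continuous_of_finiteDimensional)
  have ha := area_pos hd hE
  refine ext_inner_left ℝ fun c => ?_
  rw [faceMean, setAverage_eq, inner_smul_right, ← integral_inner hint,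
    setIntegral_inner_affineMap hd hE, ← mul_assoc]
  change (area E)⁻¹ * area E * _ = _
  rw [inv_mul_cancel₀ ha.ne', one_mul]

theorem coord_ctr_opp [DecidableEq (Vec d)] (hd : 0 < d) (T : M.cells) (p q : T.1) :
    (basis T).coord p (ctr (opp T q)) = if p = q then 0 else (d : ℝ)⁻¹ := by
  classical
  rw [affineMap_ctr _ (nonempty_of_mem_faces hd (opp_mem_faces T q)), card_opp, smul_eq_mul]
  have h (x : Vec d) (hx : x ∈ opp T q) :
      (basis T).coord p x = if (p : Vec d) = x then 1 else 0 := by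
    have h1 := (basis T).coord_apply p ⟨x, opp_subset T q hx⟩
    rw [basis_apply] at h1
    simp only [h1, Subtype.ext_iff]
  rw [Finset.sum_congr rfl h, Finset.sum_ite_eq]
  by_cases hpq : p = q
  · subst hpq
    simp [mem_opp]
  · have : (p : Vec d) ∈ opp T q := mem_opp.2 ⟨fun h' => hpq (Subtype.ext h'), p.2⟩
    simp [this, hpq]

section Interpolation

variable {X : Type*} [AddCommGroup X] [Module ℝ X]

theorem affineMap_eq_sum_coord (T : M.cells) (u : Vec d →ᵃ[ℝ] X) (x : Vec d) :
    u x = ∑ p : T.1, (basis T).coord p x • u p := by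
  have h := (basis T).affineCombination_coord_eq_self x
  have h1 := (basis T).sum_coord_apply_eq_one x
  conv_lhs => rw [← h]
  rw [Finset.map_affineCombination _ _ _ h1,
    Finset.affineCombination_eq_linear_combination _ _ _ h1]
  rfl

/-- An affine map is the Crouzeix-Raviart interpolant of its values at the face barycentres. -/
theorem affineMap_eq_sum_ctr (hd : 0 < d) (T : M.cells) (u : Vec d →ᵃ[ℝ] X) (x : Vec d) :
    u x = ∑ p : T.1, (1 - d * (basis T).coord p x) • u (ctr (opp T p)) := by
  classical
  have hd' : (d : ℝ) ≠ 0 := by positivity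
  have h1 := (basis T).sum_coord_apply_eq_one x
  -- The face opposite to `p` averages the `d` vertices other than `p`. This relation between vertex
  -- values and barycentre values is what the interpolation formula inverts.
  have hc (p : T.1) : u (ctr (opp T p)) = (d : ℝ)⁻¹ • (∑ q : T.1, u q - u p) := by
    rw [affineMap_ctr _ (nonempty_of_mem_faces hd (opp_mem_faces T p)), card_opp, opp,
      ← Finset.sum_erase_add _ _ (Finset.mem_univ p), add_sub_cancel_right]
    congr 1
    have := Finset.sum_erase_add T.1 (fun q => u q) p.2
    rw [eq_sub_of_add_eq this, ← Finset.sum_coe_sort T.1 (fun q => u q),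
      ← Finset.sum_erase_add _ _ (Finset.mem_univ p), add_sub_cancel_right]
  have hcard : (Fintype.card T.1 : ℝ) = d + 1 := by
    rw [Fintype.card_coe, M.card_eq T.1 T.2]; push_cast; ring
  have hterm (p : T.1) : (1 - d * (basis T).coord p x) • u (ctr (opp T p)) =
      ((d : ℝ)⁻¹ - (basis T).coord p x) • (∑ q : T.1, u q)
        - (d : ℝ)⁻¹ • u p + (basis T).coord p x • u p := by
    rw [hc, smul_smul, smul_sub, sub_mul, one_mul, mul_right_comm, mul_inv_cancel₀ hd', one_mul,
      sub_smul _ _ (u _)]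
    abel
  rw [Finset.sum_congr rfl fun p _ => hterm p, Finset.sum_add_distrib, Finset.sum_sub_distrib,
    ← affineMap_eq_sum_coord, ← Finset.sum_smul, Finset.sum_sub_distrib, h1, ← Finset.smul_sum,
    Finset.sum_const, Finset.card_univ, nsmul_eq_mul, hcard, ← sub_smul]
  have : ((d : ℝ) + 1) * (d : ℝ)⁻¹ - 1 - (d : ℝ)⁻¹ = 0 := by field_simp; ring
  rw [this, zero_smul, zero_add]

/-- The derivative of the interpolation formula: each basis function `1 - d λ_p` has gradient `-d
∇λ_p`. Both Green's formula and the gradient bound start here. -/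
theorem linear_eq_sum_ctr (hd : 0 < d) (T : M.cells) (u : Vec d →ᵃ[ℝ] X) (y : Vec d) :
    u.linear y = -(d : ℝ) • ∑ p : T.1, ((basis T).coord p).linear y • u (ctr (opp T p)) := by
  have h (f : Vec d →ᵃ[ℝ] X) : f.linear y = f y - f 0 := by
    rw [congrFun f.decomp y]; simp
  have h' (f : Vec d →ᵃ[ℝ] ℝ) : f.linear y = f y - f 0 := by
    rw [congrFun f.decomp y]; simp
  rw [h, affineMap_eq_sum_ctr hd T u y, affineMap_eq_sum_ctr hd T u 0, ← Finset.sum_sub_distrib,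
    Finset.smul_sum]
  refine Finset.sum_congr rfl fun p _ => ?_
  rw [h', ← sub_smul, smul_smul]
  congr 1
  ring

theorem affineMap_ext_ctr (hd : 0 < d) (T : M.cells) {u w : Vec d →ᵃ[ℝ] X}
    (h : ∀ p, u (ctr (opp T p)) = w (ctr (opp T p))) : u = w := by
  ext x
  rw [affineMap_eq_sum_ctr hd T u, affineMap_eq_sum_ctr hd T w]
  simp_rw [h]

/-- The affine map with prescribed values at the face barycentres. -/
def crInterp (T : M.cells) (a : T.1 → X) : Vec d →ᵃ[ℝ] X :=
  ∑ p : T.1, (AffineMap.lineMap (0 : X) (a p)).comp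
    (AffineMap.const ℝ (Vec d) (1 : ℝ) - (d : ℝ) • (basis T).coord p)

theorem crInterp_apply_ctr (hd : 0 < d) (T : M.cells) (a : T.1 → X) (p : T.1) :
    crInterp T a (ctr (opp T p)) = a p := by
  classical
  have hd' : (d : ℝ) ≠ 0 := by positivity
  have h (x : Vec d) : crInterp T a x = ∑ p : T.1, (1 - d * (basis T).coord p x) • a p := by
    have hsum (s : Finset T.1) (f : T.1 → Vec d →ᵃ[ℝ] X) : (∑ p ∈ s, f p) x = ∑ p ∈ s, f p x := by
      induction s using Finset.induction_on with
      | empty => simp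
      | insert a s ha ih => simp [Finset.sum_insert ha, ih]
    rw [crInterp, hsum]
    simp [AffineMap.lineMap_apply]
  rw [h, Finset.sum_eq_single p]
  · simp [coord_ctr_opp hd]
  · intro q _ hq
    simp [coord_ctr_opp hd, hq, hd']
  · simp

end Interpolation

end Mesh

/-! ### Algebra of strains and stresses. -/

section Matrices

variable {d : ℕ}

theorem frobenius_self_nonneg (A : Matrix (Fin d) (Fin d) ℝ) : 0 ≤ frobenius A A :=
  Finset.sum_nonneg fun _ _ => Finset.sum_nonneg fun _ _ => mul_self_nonneg _

theorem frobenius_comm (A B : Matrix (Fin d) (Fin d) ℝ) : frobenius A B = frobenius B A := by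
  simp only [frobenius, mul_comm]

theorem frobenius_transpose (A B : Matrix (Fin d) (Fin d) ℝ) :
    frobenius A.transpose B.transpose = frobenius A B := by
  simp only [frobenius, Matrix.transpose_apply]
  exact Finset.sum_comm

theorem frobenius_add_left (A B C : Matrix (Fin d) (Fin d) ℝ) :
    frobenius (A + B) C = frobenius A C + frobenius B C := by
  simp [frobenius, add_mul, Finset.sum_add_distrib]

theorem frobenius_smul_left (c : ℝ) (A B : Matrix (Fin d) (Fin d) ℝ) :
    frobenius (c • A) B = c * frobenius A B := by
  simp [frobenius, Finset.mul_sum, mul_assoc]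

theorem frobenius_one_left (B : Matrix (Fin d) (Fin d) ℝ) : frobenius 1 B = B.trace := by
  simp [frobenius, Matrix.trace, Matrix.one_apply]

theorem frobenius_elasticity (lam mu : ℝ) (A B : Matrix (Fin d) (Fin d) ℝ) :
    frobenius (elasticity lam mu A) B = 2 * mu * frobenius A B + lam * A.trace * B.trace := by
  rw [elasticity, frobenius_add_left, frobenius_smul_left, frobenius_smul_left, frobenius_one_left]

theorem sq_trace_le (A : Matrix (Fin d) (Fin d) ℝ) : A.trace ^ 2 ≤ d * frobenius A A := by
  have h := sq_sum_le_card_mul_sum_sq (s := Finset.univ) (f := fun i => A i i)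
  rw [Finset.card_univ, Fintype.card_fin] at h
  refine h.trans (mul_le_mul_of_nonneg_left ?_ (Nat.cast_nonneg d))
  refine Finset.sum_le_sum fun i _ => ?_
  rw [sq]
  exact Finset.single_le_sum (f := fun j => A i j * A i j) (fun j _ => mul_self_nonneg _)
    (Finset.mem_univ i)

theorem frobenius_elasticity_self_nonneg {lam mu : ℝ} (hl : 0 ≤ lam) (hm : 0 ≤ mu)
    (A : Matrix (Fin d) (Fin d) ℝ) : 0 ≤ frobenius (elasticity lam mu A) A := by
  rw [frobenius_elasticity, mul_assoc lam]
  have := frobenius_self_nonneg A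
  have := mul_self_nonneg A.trace
  positivity

/-- The weight `β₀ = d λ + 2 μ` of the reduced penalty originates here: Cauchy-Schwarz on the
diagonal costs a factor `d` in the trace term. -/
theorem frobenius_elasticity_self_le {lam mu : ℝ} (hl : 0 ≤ lam)
    (A : Matrix (Fin d) (Fin d) ℝ) :
    frobenius (elasticity lam mu A) A ≤ (d * lam + 2 * mu) * frobenius A A := by
  rw [frobenius_elasticity]
  have := mul_le_mul_of_nonneg_left (sq_trace_le A) hl
  nlinarith

theorem symGrad_transpose (u : Vec d →ᵃ[ℝ] Vec d) : (symGrad u).transpose = symGrad u := by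
  rw [symGrad, Matrix.transpose_smul, Matrix.transpose_add, Matrix.transpose_transpose, add_comm]

theorem elasticity_transpose {lam mu : ℝ} {A : Matrix (Fin d) (Fin d) ℝ} (h : A.transpose = A) :
    (elasticity lam mu A).transpose = elasticity lam mu A := by
  rw [elasticity, Matrix.transpose_add, Matrix.transpose_smul, Matrix.transpose_smul, h,
    Matrix.transpose_one]

/-- A symmetric matrix is orthogonal to the skew part of the gradient. -/
theorem frobenius_symGrad {A : Matrix (Fin d) (Fin d) ℝ} (hA : A.transpose = A)
    (u : Vec d →ᵃ[ℝ] Vec d) : frobenius A (symGrad u) = frobenius A (gradient u) := by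
  rw [frobenius_comm, symGrad, frobenius_smul_left, frobenius_add_left]
  nth_rw 2 [← hA]
  rw [frobenius_transpose, frobenius_comm A]
  ring

/-- Symmetrization is an orthogonal projection for the Frobenius product, hence a contraction. -/
theorem frobenius_symGrad_self_le (u : Vec d →ᵃ[ℝ] Vec d) :
    frobenius (symGrad u) (symGrad u) ≤ frobenius (gradient u) (gradient u) := by
  have h1 : frobenius (symGrad u) (symGrad u) = frobenius (symGrad u) (gradient u) :=
    frobenius_symGrad (symGrad_transpose u) u
  have h2 : 2 * frobenius (symGrad u) (gradient u) ≤
      frobenius (symGrad u) (symGrad u) + frobenius (gradient u) (gradient u) := by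
    simp only [frobenius, Finset.mul_sum, ← Finset.sum_add_distrib]
    refine Finset.sum_le_sum fun i _ => Finset.sum_le_sum fun j _ => ?_
    nlinarith [sq_nonneg (symGrad u i j - gradient u i j)]
  linarith

theorem linear_apply (u : Vec d →ᵃ[ℝ] Vec d) (y : Vec d) (i : Fin d) :
    u.linear y i = ∑ j, gradient u i j * y j := by
  have hy : y = ∑ j, y j • EuclideanSpace.single j (1 : ℝ) := by
    simpa using ((EuclideanSpace.basisFun (Fin d) ℝ).sum_repr y).symm
  conv_lhs => rw [hy, map_sum]
  simp [gradient, mul_comm]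

theorem norm_sq_linear_le (u : Vec d →ᵃ[ℝ] Vec d) (y : Vec d) :
    ‖u.linear y‖ ^ 2 ≤ frobenius (gradient u) (gradient u) * ‖y‖ ^ 2 := by
  rw [EuclideanSpace.real_norm_sq_eq, EuclideanSpace.real_norm_sq_eq, frobenius, Finset.sum_mul]
  refine Finset.sum_le_sum fun i _ => ?_
  rw [linear_apply]
  simpa only [sq] using Finset.sum_mul_sq_le_sq_mul_sq Finset.univ (gradient u i) y.ofLp

end Matrices

/-! ### Heights, shape regularity and estimates on a single cell. -/

namespace Mesh

variable {d : ℕ} {M : Mesh d}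

theorem hull_eq_cone (T : M.cells) (p : T.1) :
    hull T.1 = convexHull ℝ (insert (p : Vec d) (opp T p : Set (Vec d))) := by
  classical
  rw [opp, ← Finset.coe_insert, Finset.insert_erase p.2]

/-- The distance from a vertex to the opposite face, expressed through the outward normal. -/
theorem exists_height (hd : 0 < d) {T : M.cells} {p : T.1} {n : Vec d}
    (hn : IsOutwardNormal T.1 (opp T p) n) :
    ∃ h : ℝ, 0 < h ∧ (∀ y, ((basis T).coord p).linear y = -(inner ℝ n y / h)) ∧
      (volume : Measure (Vec d)).real (hull T.1) * d = area (opp T p) * h := by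
  classical
  obtain ⟨hn1, horth, hout⟩ := hn
  obtain ⟨e, he⟩ := nonempty_of_mem_faces hd (opp_mem_faces T p)
  have hpn : (p : Vec d) ∉ opp T p := fun h => (mem_opp.1 h).1 rfl
  set h : ℝ := inner ℝ n (e - p) with hh
  have hpos : 0 < h := by
    have := hout e he p p.2 hpn
    rw [← neg_sub, inner_neg_right] at this
    linarith
  have hE : ∀ x ∈ opp T p, inner ℝ n (x - p) = h := by
    intro x hx
    have := horth e he x hx
    rw [hh, ← sub_add_sub_cancel x e, inner_add_right, this, zero_add]
  refine ⟨h, hpos, fun y => ?_, ?_⟩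
  · have hcoord (x : Vec d) : (basis T).coord p x = 1 - inner ℝ n (x - p) / h := by
      -- This affine function is `1` at `p` and `0` at the other vertices, so it is the barycentric
      -- coordinate of `p`; its gradient is `-n / h`.
      let f : Vec d →ᵃ[ℝ] ℝ := AffineMap.const ℝ (Vec d) (1 : ℝ) -
        h⁻¹ • (innerₛₗ ℝ n).toAffineMap.comp
          (AffineMap.id ℝ (Vec d) - AffineMap.const ℝ _ (p : Vec d))
      have hf (x : Vec d) : f x = 1 - inner ℝ n (x - p) / h := by
        simp [f, div_eq_inv_mul]
      rw [← hf, affineMap_eq_sum_coord T f x, Finset.sum_eq_single p]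
      · simp [hf]
      · intro q _ hq
        have hq' : (q : Vec d) ∈ opp T p := mem_opp.2 ⟨fun h' => hq (Subtype.ext h'), q.2⟩
        rw [hf, hE q hq', div_self hpos.ne', sub_self, smul_zero]
      · simp
    have hlin : ((basis T).coord p).linear y = (basis T).coord p y - (basis T).coord p 0 := by
      rw [congrFun ((basis T).coord p).decomp y]; simp
    rw [hlin, hcoord, hcoord, zero_sub, inner_sub_right, inner_neg_right]
    ring
  · rw [hull_eq_cone T p]
    exact volume_cone hd ⟨e, he⟩ hn1 hpos hE

theorem faceSize_nonneg (E : Finset (Vec d)) : 0 ≤ faceSize E := Metric.diam_nonneg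

/-- A face has two distinct vertices as soon as `d ≥ 2`; in dimension one it would be a point of
diameter zero. -/
theorem faceSize_pos (hd : 2 ≤ d) {E : Finset (Vec d)} (hE : E ∈ M.faces) : 0 < faceSize E := by
  obtain ⟨x, hx, y, hy, hxy⟩ := Finset.one_lt_card.1
    (show 1 < E.card by rw [card_of_mem_faces hE]; omega)
  refine (dist_pos.2 hxy).trans_le (Metric.dist_le_diam_of_mem ?_ ?_ ?_)
  · exact (E.finite_toSet.isCompact_convexHull (𝕜 := ℝ)).isBounded
  · exact subset_convexHull ℝ _ hx
  · exact subset_convexHull ℝ _ hy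

/-- In a shape regular mesh the heights of a cell dominate the diameters of its faces. -/
theorem faceSize_le_height {σ : ℝ} (hσ : 0 < σ) (hM : M.ShapeRegular σ) {T : M.cells}
    {p : T.1} {n : Vec d} {h : ℝ} (hn : ‖n‖ = 1) (hh : 0 < h)
    (hlin : ∀ y, ((basis T).coord p).linear y = -(inner ℝ n y / h)) :
    faceSize (opp T p) ≤ σ * h := by
  obtain ⟨c, hc⟩ := hM T.1 T.2
  set r := Metric.diam (hull T.1) / σ with hr
  have hr0 : 0 ≤ r := div_nonneg Metric.diam_nonneg hσ.le
  have hdiam : faceSize (opp T p) ≤ Metric.diam (hull T.1) :=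
    Metric.diam_mono (convexHull_mono (by exact_mod_cast opp_subset T p))
      (T.1.finite_toSet.isCompact_convexHull (𝕜 := ℝ)).isBounded
  have hle (x : Vec d) (hx : x ∈ hull T.1) :
      0 ≤ (basis T).coord p x ∧ (basis T).coord p x ≤ 1 := by
    have h1 := (mem_hull_iff T x).1 hx
    refine ⟨h1 p, ?_⟩
    rw [← (basis T).sum_coord_apply_eq_one x]
    exact Finset.single_le_sum (f := fun q => (basis T).coord q x) (fun q _ => h1 q)
      (Finset.mem_univ p)
  have h0 := hle c (hc (Metric.mem_closedBall_self hr0))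
  -- Moving from the centre `c` of the inscribed ball by its radius against the normal raises the
  -- coordinate of `p` by `r / h`. Both endpoints lie in the cell, where the coordinate stays in
  -- `[0, 1]`, so `r ≤ h`.
  have h1 := hle (-(r • n) + c) (hc (by simp [norm_smul, hn, abs_of_nonneg hr0]))
  have h2 := ((basis T).coord p).map_vadd c (-(r • n))
  rw [vadd_eq_add, vadd_eq_add, hlin, inner_neg_right, inner_smul_right,
    real_inner_self_eq_norm_sq, hn] at h2
  have h3 : r / h ≤ 1 := by
    have : -(-(r * 1 ^ 2) / h) = r / h := by ring
    linarith [h1.2, h0.1]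
  have h4 : r ≤ h := (div_le_one hh).1 h3
  calc faceSize (opp T p) ≤ Metric.diam (hull T.1) := hdiam
    _ = σ * r := by rw [hr]; field_simp
    _ ≤ σ * h := mul_le_mul_of_nonneg_left h4 hσ.le

/-- Combines the cone formula `|T| d = |E| h` with `h_E ≤ σ h`. -/
theorem faceSize_mul_area_le (hd : 0 < d) {σ : ℝ} (hσ : 0 < σ) (hM : M.ShapeRegular σ)
    {T : M.cells} {p : T.1} {n : Vec d} (hn : IsOutwardNormal T.1 (opp T p) n) :
    faceSize (opp T p) * area (opp T p) ≤ d * σ * (volume : Measure (Vec d)).real (hull T.1) := by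
  obtain ⟨h, hh, hlin, hvol⟩ := exists_height hd hn
  have h1 := faceSize_le_height hσ hM hn.1 hh hlin
  have h2 := area_pos hd (opp_mem_faces T p)
  nlinarith

theorem gradient_eq_sum_ctr (hd : 0 < d) (T : M.cells) (u : Vec d →ᵃ[ℝ] Vec d) (i j : Fin d) :
    gradient u i j = -(d : ℝ) * ∑ p : T.1,
      ((basis T).coord p).linear (EuclideanSpace.single j 1) * u (ctr (opp T p)) i := by
  rw [gradient, Matrix.of_apply, linear_eq_sum_ctr hd T u]
  simp

/-- Green's formula on a cell for a constant symmetric stress and an affine displacement. -/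
theorem volume_mul_frobenius_symGrad (hd : 0 < d) {T : M.cells} {N : T.1 → Vec d}
    (hN : ∀ p, IsOutwardNormal T.1 (opp T p) (N p)) {A : Matrix (Fin d) (Fin d) ℝ}
    (hA : A.transpose = A) (u : Vec d →ᵃ[ℝ] Vec d) :
    (volume : Measure (Vec d)).real (hull T.1) * frobenius A (symGrad u) =
      ∑ p : T.1, area (opp T p) *
        inner ℝ (WithLp.toLp 2 (A.mulVec (WithLp.ofLp (N p)))) (u (ctr (opp T p))) := by
  set V := (volume : Measure (Vec d)).real (hull T.1) with hV
  -- The identity `-d |T| ∇λ_p = |E_p| N_p`: the gradient is `-N_p / h`, and `d |T| = |E_p| h`. With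
  -- it, the interpolation formula for the gradient becomes the boundary sum.
  have hg (p : T.1) (j : Fin d) :
      V * (-(d : ℝ) * ((basis T).coord p).linear (EuclideanSpace.single j 1)) =
        area (opp T p) * N p j := by
    obtain ⟨h, hh, hlin, hvol⟩ := exists_height hd (hN p)
    rw [hlin, EuclideanSpace.inner_single_right]
    simp only [conj_trivial, one_mul]
    rw [← hV] at hvol
    field_simp
    linear_combination (N p j) * hvol
  rw [frobenius_symGrad hA, frobenius, Finset.mul_sum]
  simp_rw [PiLp.inner_apply, Matrix.mulVec, dotProduct, Finset.mul_sum]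
  rw [Finset.sum_comm (s := (Finset.univ : Finset T.1))]
  refine Finset.sum_congr rfl fun i _ => ?_
  simp only [RCLike.inner_apply, conj_trivial, Finset.mul_sum]
  rw [Finset.sum_comm]
  refine Finset.sum_congr rfl fun j _ => ?_
  rw [gradient_eq_sum_ctr hd T, Finset.mul_sum, Finset.mul_sum, Finset.mul_sum]
  refine Finset.sum_congr rfl fun p _ => ?_
  linear_combination (A i j * u (ctr (opp T p)) i) * hg p j

/-- An inverse estimate. The gradient is `-d ∑ u(E_p) ⊗ ∇λ_p` with `|∇λ_p| = 1 / h`. Cauchy-Schwarz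
over the `d + 1` faces gives the factor `d + 1`, one factor `d` is spent on `d |T| = |E_p| h`, and
shape regularity replaces `1 / h` by `σ / h_E`. -/
theorem volume_mul_frobenius_gradient_le (hd : 2 ≤ d) {σ : ℝ} (hσ : 0 < σ)
    (hM : M.ShapeRegular σ) {T : M.cells} {N : T.1 → Vec d}
    (hN : ∀ p, IsOutwardNormal T.1 (opp T p) (N p)) (u : Vec d →ᵃ[ℝ] Vec d) :
    (volume : Measure (Vec d)).real (hull T.1) * frobenius (gradient u) (gradient u) ≤
      d * (d + 1) * σ * ∑ p : T.1,
        (faceSize (opp T p))⁻¹ * area (opp T p) * ‖u (ctr (opp T p))‖ ^ 2 := by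
  have hd0 : 0 < d := by omega
  set V := (volume : Measure (Vec d)).real (hull T.1) with hV
  have hV0 : 0 ≤ V := measureReal_nonneg
  set g : T.1 → Fin d → ℝ := fun p j =>
    ((basis T).coord p).linear (EuclideanSpace.single j 1) with hgdef
  have hcard : ((Finset.univ : Finset T.1).card : ℝ) = d + 1 := by
    rw [Finset.card_univ, Fintype.card_coe, M.card_eq T.1 T.2]; push_cast; ring
  have hg (p : T.1) : d * (V * ∑ j, g p j ^ 2) ≤ σ * ((faceSize (opp T p))⁻¹ * area (opp T p)) := by
    obtain ⟨h, hh, hlin, hvol⟩ := exists_height hd0 (hN p)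
    have hs := faceSize_pos hd (opp_mem_faces T p)
    have hle := faceSize_le_height hσ hM (hN p).1 hh hlin
    have ha := area_pos hd0 (opp_mem_faces T p)
    have h1 : ∑ j, g p j ^ 2 = (h⁻¹) ^ 2 := by
      simp_rw [hgdef, hlin, EuclideanSpace.inner_single_right]
      simp only [conj_trivial, one_mul, neg_sq, div_pow]
      rw [← Finset.sum_div, ← EuclideanSpace.real_norm_sq_eq, (hN p).1]
      simp
    rw [h1]
    rw [← hV] at hvol
    have h2 : d * (V * h⁻¹ ^ 2) = h⁻¹ * area (opp T p) := by
      rw [← mul_assoc, mul_comm (d : ℝ), hvol]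
      field_simp
    rw [h2, ← mul_assoc]
    refine mul_le_mul_of_nonneg_right ?_ ha.le
    rw [inv_le_iff_one_le_mul₀ hh, mul_assoc, mul_comm _ h, ← mul_assoc, ← div_eq_mul_inv,
      one_le_div hs]
    exact hle
  have hgrad (i j : Fin d) : gradient u i j * gradient u i j ≤
      (d : ℝ) ^ 2 * (d + 1) * ∑ p : T.1, g p j ^ 2 * u (ctr (opp T p)) i ^ 2 := by
    rw [gradient_eq_sum_ctr hd0 T u i j, ← sq, mul_pow, neg_sq, mul_assoc]
    refine mul_le_mul_of_nonneg_left ?_ (sq_nonneg _)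
    have := sq_sum_le_card_mul_sum_sq (s := (Finset.univ : Finset T.1))
      (f := fun p => g p j * u (ctr (opp T p)) i)
    rw [hcard] at this
    simpa only [mul_pow] using this
  calc V * frobenius (gradient u) (gradient u)
      ≤ V * ∑ i, ∑ j, ((d : ℝ) ^ 2 * (d + 1) * ∑ p : T.1, g p j ^ 2 * u (ctr (opp T p)) i ^ 2) :=
        mul_le_mul_of_nonneg_left
          (Finset.sum_le_sum fun i _ => Finset.sum_le_sum fun j _ => hgrad i j) hV0
    _ = d * (d + 1) * ∑ p : T.1, (d * (V * ∑ j, g p j ^ 2)) * ‖u (ctr (opp T p))‖ ^ 2 := by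
        simp_rw [EuclideanSpace.real_norm_sq_eq, Finset.mul_sum, Finset.sum_mul, Finset.mul_sum]
        rw [Finset.sum_congr rfl fun i _ => Finset.sum_comm, Finset.sum_comm]
        refine Finset.sum_congr rfl fun p _ => Finset.sum_congr rfl fun i _ =>
          Finset.sum_congr rfl fun j _ => ?_
        ring
    _ ≤ d * (d + 1) * ∑ p : T.1,
          (σ * ((faceSize (opp T p))⁻¹ * area (opp T p))) * ‖u (ctr (opp T p))‖ ^ 2 := by
        refine mul_le_mul_of_nonneg_left (Finset.sum_le_sum fun p _ => ?_) (by positivity)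
        exact mul_le_mul_of_nonneg_right (hg p) (sq_nonneg _)
    _ = _ := by
        rw [mul_assoc _ σ, Finset.mul_sum _ _ σ]
        simp_rw [mul_assoc]

end Mesh

/-! ### Orientation: the cells on the two sides of a face. -/

namespace Mesh

variable {d : ℕ} {M : Mesh d}

theorem not_isOutwardNormal_neg (hd : 0 < d) {T : M.cells} {p : T.1} {n : Vec d}
    (h : IsOutwardNormal T.1 (opp T p) n) : ¬ IsOutwardNormal T.1 (opp T p) (-n) := by
  intro h'
  obtain ⟨e, he⟩ := nonempty_of_mem_faces hd (opp_mem_faces T p)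
  have hpn : (p : Vec d) ∉ opp T p := fun h => (mem_opp.1 h).1 rfl
  have h1 := h.2.2 e he p p.2 hpn
  have h2 := h'.2.2 e he p p.2 hpn
  rw [inner_neg_left] at h2
  linarith

/-- The opposite vertex `p` cannot lie in the hyperplane of the face, because the vertices of a cell
span the whole space; the sign of its height decides the alternative. -/
theorem isOutwardNormal_or (hd : 0 < d) (𝔫 : M.FaceNormals) (T : M.cells) (p : T.1) :
    IsOutwardNormal T.1 (opp T p) (𝔫.normal (opp T p)) ∨
      IsOutwardNormal T.1 (opp T p) (-𝔫.normal (opp T p)) := by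
  classical
  have hE := opp_mem_faces T p
  set n := 𝔫.normal (opp T p) with hn
  have hn1 : ‖n‖ = 1 := 𝔫.norm_eq _ hE
  have horth := 𝔫.orthogonal _ hE
  rw [← hn] at horth
  obtain ⟨e, he⟩ := nonempty_of_mem_faces hd hE
  have hdiff (x : Vec d) (hx : x ∈ opp T p) : inner ℝ n (↑p - x) = inner ℝ n (↑p - e) := by
    rw [← sub_add_sub_cancel (p : Vec d) e x, inner_add_right, horth x hx e he, add_zero]
  have hp (y : Vec d) (hy : y ∈ T.1) (hyE : y ∉ opp T p) : y = p := by
    by_contra hne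
    exact hyE (mem_opp.2 ⟨hne, hy⟩)
  have hne : inner ℝ n (↑p - e) ≠ 0 := by
    intro h0
    have hall : ∀ q : T.1, inner ℝ n (↑q - e) = 0 := by
      intro q
      by_cases hq : (q : Vec d) ∈ opp T p
      · exact horth e he q hq
      · rw [hp q q.2 hq, h0]
    -- If every vertex had height zero, the affine function `x ↦ ⟨n, x - e⟩` would vanish
    -- identically, yet its value at `e + n` is `1`.
    have hx := affineMap_eq_sum_coord T ((innerₛₗ ℝ n).toAffineMap.comp
      (AffineMap.id ℝ (Vec d) - AffineMap.const ℝ (Vec d) e)) (e + n)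
    simp [hall, hn1] at hx
  rcases hne.lt_or_gt with h | h
  · refine Or.inl ⟨hn1, horth, fun x hx y hy hyE => ?_⟩
    rw [hp y hy hyE, hdiff x hx]
    exact h
  · refine Or.inr ⟨by rw [norm_neg, hn1], fun x hx y hy => ?_, fun x hx y hy hyE => ?_⟩
    · rw [inner_neg_left, horth x hx y hy, neg_zero]
    · rw [hp y hy hyE, inner_neg_left, hdiff x hx]
      linarith

theorem insert_opp [DecidableEq (Vec d)] (T : M.cells) (p : T.1) :
    insert (p : Vec d) (opp T p) = T.1 := by
  ext x
  simp only [Finset.mem_insert, mem_opp]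
  constructor
  · rintro (rfl | h)
    exacts [p.2, h.2]
  · intro hx
    by_cases h : x = p
    exacts [Or.inl h, Or.inr ⟨h, hx⟩]

/-- By conformity, a face has at most one cell on each of its sides. -/
theorem eq_of_isOutwardNormal (hd : 0 < d) {T T' : M.cells} {p : T.1} {p' : T'.1}
    (hE : opp T p = opp T' p') {n : Vec d} (hT : IsOutwardNormal T.1 (opp T p) n)
    (hT' : IsOutwardNormal T'.1 (opp T' p') n) : T = T' := by
  classical
  by_contra hne
  have hpp : (p : Vec d) ≠ p' := by
    intro h
    refine hne (Subtype.ext ?_)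
    rw [← insert_opp T p, ← insert_opp T' p', h, hE]
  obtain ⟨h, hh, hlin, -⟩ := exists_height hd hT
  obtain ⟨h', hh', hlin', -⟩ := exists_height hd hT'
  set c := ctr (opp T p) with hc
  have hc' : c = ctr (opp T' p') := by rw [hc, hE]
  -- Walk from the barycentre `c` of the common face towards `p`. For small `t > 0` the point lies
  -- in both cells, hence by conformity in the hull of their common vertices. None of these is `p`,
  -- so the coordinate of `p` should vanish there, whereas it equals `t`.
  let x : ℝ → Vec d := fun t => t • ((p : Vec d) - c) + c
  have hx (T : M.cells) (q : T.1) (t : ℝ) :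
      (basis T).coord q (x t) = t * ((basis T).coord q).linear (p - c) + (basis T).coord q c := by
    have := ((basis T).coord q).map_vadd c (t • ((p : Vec d) - c))
    rw [map_smul] at this
    simpa using this
  have hpc : ((basis T).coord p).linear (p - c) = 1 := by
    have := ((basis T).coord p).linearMap_vsub p c
    rw [vsub_eq_sub, vsub_eq_sub, hc, coord_ctr_opp hd, if_pos rfl, sub_zero,
      ← basis_apply T p, AffineBasis.coord_apply_eq] at this
    exact this
  -- With the same normal for both cells the walk also goes into `T'`: the coordinate of `p'` grows
  -- at the rate `h / h'`. The other coordinates of `T'` are positive at `c`, so they stay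
  -- nonnegative for small `t`.
  have hpos : 0 ≤ ((basis T').coord p').linear (p - c) := by
    have h1 : ((basis T').coord p').linear (p - c) = h / h' := by
      rw [hlin] at hpc
      rw [hlin']
      have : inner ℝ n ((p : Vec d) - c) = -h := by
        field_simp at hpc
        linarith
      rw [this]; ring
    rw [h1]
    positivity
  have hev : ∀ᶠ t in nhdsWithin (0 : ℝ) (Set.Ioi 0), ∀ q : T'.1, 0 ≤ (basis T').coord q (x t) := by
    rw [Filter.eventually_all]
    intro q
    by_cases hq : q = p'
    · subst hq
      filter_upwards [self_mem_nhdsWithin] with t ht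
      rw [hx, hc', coord_ctr_opp hd, if_pos rfl, add_zero, ← hc']
      exact mul_nonneg (le_of_lt ht) hpos
    · refine Filter.Eventually.filter_mono nhdsWithin_le_nhds ?_
      have hcont : Continuous fun t => (basis T').coord q (x t) := by
        simp_rw [hx]
        fun_prop
      have h0 : 0 < (basis T').coord q (x 0) := by
        rw [hx, hc', coord_ctr_opp hd, if_neg hq]
        have : (0 : ℝ) < d := by exact_mod_cast hd
        simpa using this
      exact (hcont.continuousAt.eventually (lt_mem_nhds h0)).mono fun t ht => ht.le
  have hev1 : ∀ᶠ t in nhdsWithin (0 : ℝ) (Set.Ioi 0), t ≤ 1 :=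
    Filter.Eventually.filter_mono nhdsWithin_le_nhds (ge_mem_nhds one_pos)
  obtain ⟨t, ⟨hxT', ht1⟩, ht0⟩ := ((hev.and hev1).and self_mem_nhdsWithin).exists
  have ht0' : 0 < t := ht0
  have hmemT : x t ∈ hull T.1 := by
    rw [mem_hull_iff]
    intro q
    have hlinq : ((basis T).coord q).linear (p - c) = (basis T).coord q p - (basis T).coord q c :=
      ((basis T).coord q).linearMap_vsub p c
    have h1 : 0 ≤ (basis T).coord q p := by
      rw [← basis_apply T p, AffineBasis.coord_apply]
      split_ifs <;> norm_num
    have h2 : 0 ≤ (basis T).coord q c := by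
      rw [hc, coord_ctr_opp hd]
      split_ifs
      · exact le_rfl
      · positivity
    rw [hx, hlinq]
    nlinarith
  have hmem : x t ∈ convexHull ℝ ((T.1 : Set (Vec d)) ∩ (T'.1 : Set (Vec d))) := by
    rw [← M.conforming T.1 T.2 T'.1 T'.2]
    exact ⟨hmemT, (mem_hull_iff T' _).2 hxT'⟩
  have hzero : convexHull ℝ ((T.1 : Set (Vec d)) ∩ (T'.1 : Set (Vec d))) ⊆
      (basis T).coord p ⁻¹' {0} := by
    refine convexHull_min ?_ ((convex_singleton (0 : ℝ)).affine_preimage _)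
    rintro y ⟨hy, hy'⟩
    have hyp : y ≠ p := by
      rintro rfl
      have : (p : Vec d) ∈ opp T p := by
        rw [hE]
        exact mem_opp.2 ⟨hpp, hy'⟩
      exact (mem_opp.1 this).1 rfl
    have := (basis T).coord_apply p ⟨y, hy⟩
    rw [if_neg fun h => hyp (congrArg Subtype.val h).symm] at this
    exact this
  have h0 := hzero hmem
  rw [Set.mem_preimage, Set.mem_singleton_iff, hx, hpc, hc, coord_ctr_opp hd, if_pos rfl] at h0
  linarith

section Sides

variable (𝔫 : M.FaceNormals)

theorem mem_plusCells {E : Finset (Vec d)} {T : M.cells} :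
    T ∈ plusCells 𝔫 E ↔ E ⊆ T.1 ∧ IsOutwardNormal T.1 E (𝔫.normal E) := by
  simp [plusCells]

theorem mem_minusCells {E : Finset (Vec d)} {T : M.cells} :
    T ∈ minusCells 𝔫 E ↔ E ⊆ T.1 ∧ IsOutwardNormal T.1 E (-𝔫.normal E) := by
  simp [minusCells]

theorem card_plusCells_le (hd : 0 < d) {E : Finset (Vec d)} (hE : E ∈ M.faces) :
    (plusCells 𝔫 E).card ≤ 1 := by
  refine Finset.card_le_one.2 fun T hT T' hT' => ?_
  rw [mem_plusCells] at hT hT'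
  obtain ⟨p, hp⟩ := exists_opp_eq T hT.1 (card_of_mem_faces hE)
  obtain ⟨p', hp'⟩ := exists_opp_eq T' hT'.1 (card_of_mem_faces hE)
  exact eq_of_isOutwardNormal hd (n := 𝔫.normal E) (hp.trans hp'.symm)
    (by rw [hp]; exact hT.2) (by rw [hp']; exact hT'.2)

theorem card_minusCells_le (hd : 0 < d) {E : Finset (Vec d)} (hE : E ∈ M.faces) :
    (minusCells 𝔫 E).card ≤ 1 := by
  refine Finset.card_le_one.2 fun T hT T' hT' => ?_
  rw [mem_minusCells] at hT hT'
  obtain ⟨p, hp⟩ := exists_opp_eq T hT.1 (card_of_mem_faces hE)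
  obtain ⟨p', hp'⟩ := exists_opp_eq T' hT'.1 (card_of_mem_faces hE)
  exact eq_of_isOutwardNormal hd (n := -𝔫.normal E) (hp.trans hp'.symm)
    (by rw [hp]; exact hT.2) (by rw [hp']; exact hT'.2)

theorem disjoint_plusCells_minusCells (hd : 0 < d) {E : Finset (Vec d)} (hE : E ∈ M.faces) :
    Disjoint (plusCells 𝔫 E) (minusCells 𝔫 E) := by
  rw [Finset.disjoint_left]
  intro T hT hT'
  rw [mem_plusCells] at hT
  rw [mem_minusCells] at hT'
  obtain ⟨p, rfl⟩ := exists_opp_eq T hT.1 (card_of_mem_faces hE)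
  exact not_isOutwardNormal_neg hd hT.2 hT'.2

theorem mem_plusCells_or_minusCells (hd : 0 < d) {E : Finset (Vec d)} (hE : E ∈ M.faces)
    {T : M.cells} : (T ∈ plusCells 𝔫 E ∨ T ∈ minusCells 𝔫 E) ↔ E ⊆ T.1 := by
  rw [mem_plusCells, mem_minusCells]
  constructor
  · rintro (h | h) <;> exact h.1
  · intro h
    obtain ⟨p, rfl⟩ := exists_opp_eq T h (card_of_mem_faces hE)
    exact (isOutwardNormal_or hd 𝔫 T p).imp (⟨h, ·⟩) (⟨h, ·⟩)

/-- Links the count of adjacent cells, which defines interior and boundary faces, to the signed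
sides, which define jumps and averages. -/
theorem card_cellsAt (hd : 0 < d) {E : Finset (Vec d)} (hE : E ∈ M.faces) :
    (M.cellsAt E).card = (plusCells 𝔫 E).card + (minusCells 𝔫 E).card := by
  classical
  rw [← Finset.card_union_of_disjoint (disjoint_plusCells_minusCells 𝔫 hd hE)]
  have : M.cellsAt E = (plusCells 𝔫 E ∪ minusCells 𝔫 E).map (Function.Embedding.subtype _) := by
    ext T
    simp only [cellsAt, Finset.mem_filter, Finset.mem_map, Finset.mem_union,
      mem_plusCells_or_minusCells 𝔫 hd hE]
    constructor
    · rintro ⟨h, h'⟩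
      exact ⟨⟨T, h⟩, h', rfl⟩
    · rintro ⟨T', h, rfl⟩
      exact ⟨T'.2, h⟩
  rw [this, Finset.card_map]

theorem exists_sides_of_mem_interiorFaces (hd : 0 < d) {E : Finset (Vec d)}
    (hE : E ∈ M.interiorFaces) : ∃ P Q, plusCells 𝔫 E = {P} ∧ minusCells 𝔫 E = {Q} := by
  simp only [interiorFaces, Finset.mem_filter] at hE
  have h1 := card_plusCells_le 𝔫 hd hE.1
  have h2 := card_minusCells_le 𝔫 hd hE.1
  have h3 := card_cellsAt 𝔫 hd hE.1
  rw [hE.2] at h3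
  obtain ⟨P, hP⟩ := Finset.card_eq_one.1 (show (plusCells 𝔫 E).card = 1 by omega)
  obtain ⟨Q, hQ⟩ := Finset.card_eq_one.1 (show (minusCells 𝔫 E).card = 1 by omega)
  exact ⟨P, Q, hP, hQ⟩

/-- The prescribed normal is outward on a boundary face, which puts its only cell on the plus side;
taking the plus trace as the boundary value is thus legitimate. -/
theorem exists_side_of_mem_boundaryFaces (hd : 0 < d) {E : Finset (Vec d)}
    (hE : E ∈ M.boundaryFaces) : ∃ P, plusCells 𝔫 E = {P} ∧ minusCells 𝔫 E = ∅ := by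
  have hE' := hE
  simp only [boundaryFaces, Finset.mem_filter] at hE'
  have h3 := card_cellsAt 𝔫 hd hE'.1
  rw [hE'.2] at h3
  have hpos : 0 < (plusCells 𝔫 E).card := by
    obtain ⟨T, hT, -⟩ := mem_faces.1 hE'.1
    have hmem : T.1 ∈ M.cellsAt E := by
      simp only [cellsAt, Finset.mem_filter]
      exact ⟨T.2, hT⟩
    exact Finset.card_pos.2 ⟨T, (mem_plusCells 𝔫).2 ⟨hT, 𝔫.outward E hE T.1 hmem⟩⟩
  obtain ⟨P, hP⟩ := Finset.card_eq_one.1 (show (plusCells 𝔫 E).card = 1 by omega)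
  exact ⟨P, hP, Finset.card_eq_zero.1 (by omega)⟩

theorem mem_interiorFaces_or_boundaryFaces (𝔫 : M.FaceNormals) (hd : 0 < d)
    {E : Finset (Vec d)} (hE : E ∈ M.faces) : E ∈ M.interiorFaces ∨ E ∈ M.boundaryFaces := by
  simp only [interiorFaces, boundaryFaces, Finset.mem_filter]
  have h1 := card_plusCells_le 𝔫 hd hE
  have h2 := card_minusCells_le 𝔫 hd hE
  have h3 := card_cellsAt 𝔫 hd hE
  have hpos : 0 < (M.cellsAt E).card := by
    obtain ⟨T, hT, -⟩ := mem_faces.1 hE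
    exact Finset.card_pos.2 ⟨T.1, by simp only [cellsAt, Finset.mem_filter]; exact ⟨T.2, hT⟩⟩
  have : (M.cellsAt E).card = 2 ∨ (M.cellsAt E).card = 1 := by omega
  exact this.imp (⟨hE, ·⟩) (⟨hE, ·⟩)

theorem notMem_interiorFaces_of_mem_boundaryFaces {E : Finset (Vec d)}
    (hE : E ∈ M.boundaryFaces) : E ∉ M.interiorFaces := by
  simp only [interiorFaces, boundaryFaces, Finset.mem_filter] at *
  intro h
  omega

/-- Summation over the faces of all cells, rearranged by faces. -/
theorem sum_cells_eq_sum_faces (hd : 0 < d) (f : M.cells → Finset (Vec d) → ℝ) :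
    ∑ T : M.cells, ∑ p : T.1, f T (opp T p) =
      ∑ E ∈ M.faces, (∑ T ∈ plusCells 𝔫 E, f T E + ∑ T ∈ minusCells 𝔫 E, f T E) := by
  classical
  have h1 (T : M.cells) : ∑ p : T.1, f T (opp T p) = ∑ E ∈ M.faces with E ⊆ T.1, f T E := by
    have himg : M.faces.filter (· ⊆ T.1) = Finset.univ.image (opp T) := by
      ext E
      simp only [Finset.mem_filter, Finset.mem_image, Finset.mem_univ, true_and]
      constructor
      · rintro ⟨hE, hET⟩
        exact exists_opp_eq T hET (card_of_mem_faces hE)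
      · rintro ⟨p, rfl⟩
        exact ⟨opp_mem_faces T p, opp_subset T p⟩
    rw [himg, Finset.sum_image (opp_injective T).injOn]
  have h2 (E : Finset (Vec d)) (hE : E ∈ M.faces) :
      ∑ T ∈ plusCells 𝔫 E, f T E + ∑ T ∈ minusCells 𝔫 E, f T E =
        ∑ T : M.cells with E ⊆ T.1, f T E := by
    rw [← Finset.sum_union (disjoint_plusCells_minusCells 𝔫 hd hE)]
    congr 1
    ext T
    simp [mem_plusCells_or_minusCells 𝔫 hd hE]
  rw [Finset.sum_congr rfl fun T _ => h1 T, Finset.sum_congr rfl h2]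
  exact Finset.sum_comm' (by simp [and_comm])

end Sides

end Mesh

/-! ### Jumps and averages at barycentres, and the direct sum. -/

namespace Mesh

variable {d : ℕ} {M : Mesh d} (𝔫 : M.FaceNormals)

theorem jumpOn_eq (u : M.VDG) (E : Finset (Vec d)) : jumpOn 𝔫 u E = ⇑(jump 𝔫 E u) := by
  have hsum (s : Finset M.cells) (x : Vec d) : (∑ T ∈ s, u T) x = ∑ T ∈ s, u T x := by
    classical
    induction s using Finset.induction_on with
    | empty => simp
    | insert a s ha ih => simp [Finset.sum_insert ha, ih]
  ext1 x
  simp only [jumpOn, jump, plusTrace, minusTrace]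
  split_ifs <;> simp [hsum]

theorem avgOn_eq (u : M.VDG) (E : Finset (Vec d)) : avgOn 𝔫 u E = ⇑(avg 𝔫 E u) := by
  have hsum (s : Finset M.cells) (x : Vec d) : (∑ T ∈ s, u T) x = ∑ T ∈ s, u T x := by
    classical
    induction s using Finset.induction_on with
    | empty => simp
    | insert a s ha ih => simp [Finset.sum_insert ha, ih]
  ext1 x
  simp only [avgOn, avg, plusTrace, minusTrace]
  split_ifs <;> simp [hsum]

theorem faceMean_jumpOn (hd : 0 < d) {E : Finset (Vec d)} (hE : E ∈ M.faces) (u : M.VDG) :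
    faceMean E (jumpOn 𝔫 u E) = jump 𝔫 E u (ctr E) := by
  rw [jumpOn_eq, faceMean_affineMap hd hE]

theorem faceMean_avgOn (hd : 0 < d) {E : Finset (Vec d)} (hE : E ∈ M.faces) (u : M.VDG) :
    faceMean E (avgOn 𝔫 u E) = avg 𝔫 E u (ctr E) := by
  rw [avgOn_eq, faceMean_affineMap hd hE]

section Values

variable {X : Type*} [AddCommGroup X]

theorem jump_of_interior {E : Finset (Vec d)} (hE : E ∈ M.interiorFaces) {P Q : M.cells}
    (hP : plusCells 𝔫 E = {P}) (hQ : minusCells 𝔫 E = {Q}) (w : M.cells → X) :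
    jump 𝔫 E w = w P - w Q := by
  simp [jump, plusTrace, minusTrace, hE, hP, hQ]

theorem jump_of_boundary {E : Finset (Vec d)} (hE : E ∈ M.boundaryFaces) {P : M.cells}
    (hP : plusCells 𝔫 E = {P}) (w : M.cells → X) : jump 𝔫 E w = w P := by
  simp [jump, plusTrace, notMem_interiorFaces_of_mem_boundaryFaces hE, hP]

variable [Module ℝ X]

theorem avg_of_interior {E : Finset (Vec d)} (hE : E ∈ M.interiorFaces) {P Q : M.cells}
    (hP : plusCells 𝔫 E = {P}) (hQ : minusCells 𝔫 E = {Q}) (w : M.cells → X) :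
    avg 𝔫 E w = (1 / 2 : ℝ) • (w P + w Q) := by
  simp [avg, plusTrace, minusTrace, hE, hP, hQ]

theorem avg_of_boundary {E : Finset (Vec d)} (hE : E ∈ M.boundaryFaces) {P : M.cells}
    (hP : plusCells 𝔫 E = {P}) (w : M.cells → X) : avg 𝔫 E w = w P := by
  simp [avg, plusTrace, notMem_interiorFaces_of_mem_boundaryFaces hE, hP]

end Values

variable {D : Finset (Finset (Vec d))}

theorem interiorOrDirichlet_subset (hD : D ⊆ M.boundaryFaces) :
    M.interiorOrDirichlet D ⊆ M.faces := by
  intro E hE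
  rcases Finset.mem_union.1 hE with h | h
  · exact (Finset.mem_filter.1 h).1
  · exact (Finset.mem_filter.1 (hD h)).1

theorem interiorOrNeumann_subset : M.interiorOrNeumann D ⊆ M.faces := by
  intro E hE
  rcases Finset.mem_union.1 hE with h | h
  · exact (Finset.mem_filter.1 h).1
  · exact (Finset.mem_filter.1 (Finset.mem_sdiff.1 h).1).1

/-- The three types of faces: interior, Dirichlet and Neumann. -/
theorem face_cases (D : Finset (Finset (Vec d))) (hd : 0 < d) {E : Finset (Vec d)}
    (hE : E ∈ M.faces) :
    (E ∈ M.interiorFaces ∧ E ∈ M.interiorOrDirichlet D ∧ E ∈ M.interiorOrNeumann D ∧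
      ∃ P Q, plusCells 𝔫 E = {P} ∧ minusCells 𝔫 E = {Q}) ∨
    (E ∈ M.boundaryFaces ∧ E ∈ M.interiorOrDirichlet D ∧ E ∉ M.interiorOrNeumann D ∧
      ∃ P, plusCells 𝔫 E = {P} ∧ minusCells 𝔫 E = ∅) ∨
    (E ∈ M.boundaryFaces ∧ E ∉ M.interiorOrDirichlet D ∧ E ∈ M.interiorOrNeumann D ∧
      ∃ P, plusCells 𝔫 E = {P} ∧ minusCells 𝔫 E = ∅) := by
  rcases mem_interiorFaces_or_boundaryFaces 𝔫 hd hE with h | h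
  · exact Or.inl ⟨h, Finset.mem_union_left _ h, Finset.mem_union_left _ h,
      exists_sides_of_mem_interiorFaces 𝔫 hd h⟩
  · have hn := notMem_interiorFaces_of_mem_boundaryFaces h
    have hs := exists_side_of_mem_boundaryFaces 𝔫 hd h
    by_cases hED : E ∈ D
    · refine Or.inr (Or.inl ⟨h, Finset.mem_union_right _ hED, ?_, hs⟩)
      simp [interiorOrNeumann, hn, hED]
    · refine Or.inr (Or.inr ⟨h, ?_, Finset.mem_union_right _ (Finset.mem_sdiff.2 ⟨h, hED⟩), hs⟩)
      simp [interiorOrDirichlet, hn, hED]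

theorem mem_VCR_iff (hd : 0 < d) (hD : D ⊆ M.boundaryFaces) {v : M.VDG} :
    v ∈ VCR 𝔫 D ↔ ∀ E ∈ M.interiorOrDirichlet D, jump 𝔫 E v (ctr E) = 0 := by
  constructor
  · intro h E hE
    have hEf := interiorOrDirichlet_subset hD hE
    rw [← faceMean_jumpOn 𝔫 hd hEf]
    exact h E hEf hE
  · intro h E hEf hE
    rw [faceMean_jumpOn 𝔫 hd hEf]
    exact h E hE

theorem mem_Zspace_iff (hd : 0 < d) {z : M.VDG} :
    z ∈ Zspace 𝔫 D ↔ ∀ E ∈ M.interiorOrNeumann D, avg 𝔫 E z (ctr E) = 0 := by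
  constructor
  · intro h E hE
    have hEf := interiorOrNeumann_subset hE
    rw [← faceMean_avgOn 𝔫 hd hEf]
    exact h E hEf hE
  · intro h E hEf hE
    rw [faceMean_avgOn 𝔫 hd hEf]
    exact h E hE

/-- The face averages and the face jumps are unisolvent. -/
theorem isCompl_VCR_Zspace (hd : 0 < d) (hD : D ⊆ M.boundaryFaces) :
    IsCompl (VCR 𝔫 D) (Zspace 𝔫 D) := by
  classical
  constructor
  · rw [Submodule.disjoint_def]
    intro u hv hz
    rw [mem_VCR_iff 𝔫 hd hD] at hv
    rw [mem_Zspace_iff 𝔫 hd] at hz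
    funext T
    refine affineMap_ext_ctr hd T fun p => ?_
    rw [Pi.zero_apply, AffineMap.coe_zero, Pi.zero_apply]
    have hE := opp_mem_faces T p
    have hT := (mem_plusCells_or_minusCells 𝔫 hd hE).2 (opp_subset T p)
    rcases face_cases 𝔫 D hd hE with ⟨hi, h1, h2, P, Q, hP, hQ⟩ | ⟨hb, h1, -, P, hP, hQ⟩ |
      ⟨hb, -, h2, P, hP, hQ⟩
    · have hj := hv _ h1
      have ha := hz _ h2
      rw [jump_of_interior 𝔫 hi hP hQ, AffineMap.coe_sub, Pi.sub_apply] at hj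
      rw [avg_of_interior 𝔫 hi hP hQ, AffineMap.coe_smul, Pi.smul_apply, AffineMap.coe_add,
        Pi.add_apply, sub_eq_zero.1 hj, ← two_smul ℝ (u Q _), smul_smul] at ha
      norm_num at ha
      rw [ha, sub_zero] at hj
      rw [hP, hQ, Finset.mem_singleton, Finset.mem_singleton] at hT
      rcases hT with rfl | rfl
      exacts [hj, ha]
    · have hj := hv _ h1
      rw [jump_of_boundary 𝔫 hb hP] at hj
      rw [hP, hQ] at hT
      simp only [Finset.mem_singleton, Finset.notMem_empty, or_false] at hT
      rwa [← hT] at hj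
    · have ha := hz _ h2
      rw [avg_of_boundary 𝔫 hb hP] at ha
      rw [hP, hQ] at hT
      simp only [Finset.mem_singleton, Finset.notMem_empty, or_false] at hT
      rwa [← hT] at ha
  · rw [codisjoint_iff, eq_top_iff]
    intro u _
    -- The component in `V^CR`: single-valued at the barycentres, with the averages of `u` on
    -- interior and Neumann faces and zero on Dirichlet faces. The averages of `u - v` then vanish
    -- where `𝒵` requires it.
    let v : M.VDG := fun T => crInterp T fun p =>
      if opp T p ∈ M.interiorOrNeumann D then avg 𝔫 (opp T p) u (ctr (opp T p)) else 0
    have hval (T : M.cells) (E : Finset (Vec d)) (hE : E ∈ M.faces) (hET : E ⊆ T.1) :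
        v T (ctr E) = if E ∈ M.interiorOrNeumann D then avg 𝔫 E u (ctr E) else 0 := by
      obtain ⟨p, rfl⟩ := exists_opp_eq T hET (card_of_mem_faces hE)
      exact crInterp_apply_ctr hd T _ p
    have hsub (E : Finset (Vec d)) (hE : E ∈ M.faces) (T : M.cells)
        (hT : T ∈ plusCells 𝔫 E ∨ T ∈ minusCells 𝔫 E) : E ⊆ T.1 :=
      (mem_plusCells_or_minusCells 𝔫 hd hE).1 hT
    refine Submodule.mem_sup.2 ⟨v, ?_, u - v, ?_, add_sub_cancel _ _⟩
    · rw [mem_VCR_iff 𝔫 hd hD]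
      intro E hE
      have hEf := interiorOrDirichlet_subset hD hE
      rcases face_cases 𝔫 D hd hEf with ⟨hi, h1, h2, P, Q, hP, hQ⟩ | ⟨hb, h1, h2, P, hP, hQ⟩ |
        ⟨hb, h1, h2, P, hP, hQ⟩
      · rw [jump_of_interior 𝔫 hi hP hQ, AffineMap.coe_sub, Pi.sub_apply,
          hval P E hEf (hsub E hEf P (Or.inl (by simp [hP]))),
          hval Q E hEf (hsub E hEf Q (Or.inr (by simp [hQ]))), sub_self]
      · rw [jump_of_boundary 𝔫 hb hP, hval P E hEf (hsub E hEf P (Or.inl (by simp [hP]))),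
          if_neg h2]
      · exact absurd hE h1
    · rw [mem_Zspace_iff 𝔫 hd]
      intro E hE
      have hEf := interiorOrNeumann_subset hE
      rcases face_cases 𝔫 D hd hEf with ⟨hi, h1, h2, P, Q, hP, hQ⟩ | ⟨hb, h1, h2, P, hP, hQ⟩ |
        ⟨hb, h1, h2, P, hP, hQ⟩
      · have hvP := hval P E hEf (hsub E hEf P (Or.inl (by simp [hP])))
        have hvQ := hval Q E hEf (hsub E hEf Q (Or.inr (by simp [hQ])))
        rw [if_pos h2, avg_of_interior 𝔫 hi hP hQ] at hvP hvQ
        rw [avg_of_interior 𝔫 hi hP hQ]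
        simp only [Pi.sub_apply, AffineMap.coe_smul, AffineMap.coe_add, AffineMap.coe_sub,
          Pi.smul_apply, Pi.add_apply, hvP, hvQ]
        module
      · exact absurd hE h2
      · have hvP := hval P E hEf (hsub E hEf P (Or.inl (by simp [hP])))
        rw [if_pos h2, avg_of_boundary 𝔫 hb hP] at hvP
        rw [avg_of_boundary 𝔫 hb hP, Pi.sub_apply, AffineMap.coe_sub, Pi.sub_apply, hvP, sub_self]

end Mesh

/-! ### The `L²` product of affine fields on a face. -/

section FaceProduct

variable {d : ℕ} {M : Mesh d}

/-- The `L²` product of two affine fields on a face. -/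
def faceProd (E : Finset (Vec d)) (f g : Vec d →ᵃ[ℝ] Vec d) : ℝ :=
  ∫ x in hull E, inner ℝ (f x) (g x) ∂μHE[d - 1]

theorem faceProd_comm (E : Finset (Vec d)) (f g : Vec d →ᵃ[ℝ] Vec d) :
    faceProd E f g = faceProd E g f := by
  simp only [faceProd, real_inner_comm]

theorem integrableOn_inner {E : Finset (Vec d)} (hE : E ∈ M.faces) (f g : Vec d →ᵃ[ℝ] Vec d) :
    IntegrableOn (fun x => inner ℝ (f x) (g x)) (hull E) μHE[d - 1] :=
  integrableOn_hull hE
    (f.continuous_of_finiteDimensional.inner g.continuous_of_finiteDimensional)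

theorem faceProd_add_left {E : Finset (Vec d)} (hE : E ∈ M.faces) (f f' g : Vec d →ᵃ[ℝ] Vec d) :
    faceProd E (f + f') g = faceProd E f g + faceProd E f' g := by
  simp only [faceProd, AffineMap.coe_add, Pi.add_apply, inner_add_left]
  exact integral_add (integrableOn_inner hE f g) (integrableOn_inner hE f' g)

theorem faceProd_smul_left (E : Finset (Vec d)) (c : ℝ) (f g : Vec d →ᵃ[ℝ] Vec d) :
    faceProd E (c • f) g = c * faceProd E f g := by
  simp only [faceProd, AffineMap.coe_smul, Pi.smul_apply, real_inner_smul_left]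
  exact integral_const_mul _ _

theorem faceProd_self_nonneg (E : Finset (Vec d)) (f : Vec d →ᵃ[ℝ] Vec d) : 0 ≤ faceProd E f f :=
  integral_nonneg fun _ => real_inner_self_nonneg

theorem faceProd_const_left (hd : 0 < d) {E : Finset (Vec d)} (hE : E ∈ M.faces) (c : Vec d)
    (g : Vec d →ᵃ[ℝ] Vec d) :
    faceProd E (AffineMap.const ℝ _ c) g = area E * inner ℝ c (g (ctr E)) :=
  Mesh.setIntegral_inner_affineMap hd hE c g

/-- The part of an affine field with vanishing mean on the face `E`. -/
def meanFree (E : Finset (Vec d)) (f : Vec d →ᵃ[ℝ] Vec d) : Vec d →ᵃ[ℝ] Vec d :=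
  f - AffineMap.const ℝ _ (f (ctr E))

/-- Splits off the mean of `f`; if the mean of `g` is zero, only the mean-free part of `f` is seen.
-/
theorem faceProd_eq_meanFree (hd : 0 < d) {E : Finset (Vec d)} (hE : E ∈ M.faces)
    (f g : Vec d →ᵃ[ℝ] Vec d) :
    faceProd E f g = faceProd E (meanFree E f) g + area E * inner ℝ (f (ctr E)) (g (ctr E)) := by
  rw [← faceProd_const_left hd hE, ← faceProd_add_left hE, meanFree, sub_add_cancel]

theorem faceProd_meanFree_self_le (hd : 0 < d) {E : Finset (Vec d)} (hE : E ∈ M.faces)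
    (f : Vec d →ᵃ[ℝ] Vec d) : faceProd E (meanFree E f) (meanFree E f) ≤ faceProd E f f := by
  have h0 : meanFree E f (ctr E) = 0 := by simp [meanFree]
  have h1 := faceProd_eq_meanFree hd hE f f
  have h2 := faceProd_eq_meanFree hd hE f (meanFree E f)
  rw [h0, inner_zero_right, mul_zero, add_zero, faceProd_comm] at h2
  have h3 := mul_nonneg (Mesh.area_pos hd hE).le (real_inner_self_nonneg (x := f (ctr E)))
  linarith

theorem ctr_mem_hull {E : Finset (Vec d)} (hE : E.Nonempty) : ctr E ∈ hull E := by
  have hc : (0 : ℝ) < E.card := by exact_mod_cast hE.card_pos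
  rw [ctr, Finset.smul_sum]
  refine (convex_convexHull ℝ _).sum_mem (fun _ _ => (inv_pos.2 hc).le) ?_
    fun q hq => subset_convexHull ℝ _ hq
  rw [Finset.sum_const, nsmul_eq_mul, mul_inv_cancel₀ hc.ne']

/-- On `E` the mean-free part is the linear part applied to `x - ctr E`, a vector no longer than the
diameter of the face. -/
theorem faceProd_meanFree_self_le_of_linear (hd : 0 < d) {E : Finset (Vec d)} (hE : E ∈ M.faces)
    {f : Vec d →ᵃ[ℝ] Vec d} {L : ℝ} (hL : 0 ≤ L) (hf : ∀ y, ‖f.linear y‖ ^ 2 ≤ L * ‖y‖ ^ 2) :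
    faceProd E (meanFree E f) (meanFree E f) ≤ L * faceSize E ^ 2 * area E := by
  have hcomp : IsCompact (hull E) := E.finite_toSet.isCompact_convexHull (𝕜 := ℝ)
  have hle : ∀ x ∈ hull E, inner ℝ (meanFree E f x) (meanFree E f x) ≤ L * faceSize E ^ 2 := by
    intro x hx
    have hlin : meanFree E f x = f.linear (x - ctr E) :=
      (f.linearMap_vsub x (ctr E)).symm
    rw [hlin, real_inner_self_eq_norm_sq]
    refine (hf _).trans (mul_le_mul_of_nonneg_left ?_ hL)
    rw [← dist_eq_norm]
    exact pow_le_pow_left₀ dist_nonneg (Metric.dist_le_diam_of_mem hcomp.isBounded hx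
      (ctr_mem_hull (Mesh.nonempty_of_mem_faces hd hE))) 2
  have h := setIntegral_mono_on (integrableOn_inner hE (meanFree E f) (meanFree E f))
    (integrableOn_const (C := L * faceSize E ^ 2) (hull_measure_lt_top hE).ne)
    hcomp.measurableSet hle
  rwa [setIntegral_const, smul_eq_mul, mul_comm] at h

end FaceProduct

/-! ### The terms of the bilinear form, its symmetry, and summation by parts. -/

namespace Mesh

variable {d : ℕ} {M : Mesh d} (𝔫 : M.FaceNormals) {D : Finset (Finset (Vec d))}

theorem jump_add {X : Type*} [AddCommGroup X] (E : Finset (Vec d)) (u w : M.cells → X) :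
    jump 𝔫 E (u + w) = jump 𝔫 E u + jump 𝔫 E w := by
  simp only [jump, plusTrace, minusTrace, Pi.add_apply, Finset.sum_add_distrib]
  split_ifs
  · abel
  · rfl

section Terms

variable (α₀ α₁ lam mu : ℝ)

theorem volumeTerm_eq (u w : M.VDG) :
    volumeTerm lam mu u w = ∑ T : M.cells, (volume : Measure (Vec d)).real (hull T.1) *
      frobenius (elasticity lam mu (symGrad (u T))) (symGrad (w T)) := by
  simp only [volumeTerm, setIntegral_const, smul_eq_mul]

theorem consistencyTerm_eq (hd : 0 < d) (hD : D ⊆ M.boundaryFaces) (u w : M.VDG) :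
    consistencyTerm 𝔫 D lam mu u w = ∑ E ∈ M.interiorOrDirichlet D,
      area E * inner ℝ (avgNormalStress 𝔫 lam mu u E) (jump 𝔫 E w (ctr E)) := by
  refine Finset.sum_congr rfl fun E hE => ?_
  rw [jumpOn_eq, setIntegral_inner_affineMap hd (interiorOrDirichlet_subset hD hE)]

theorem penalty₀_eq (hd : 0 < d) (hD : D ⊆ M.boundaryFaces) (u w : M.VDG) :
    penalty₀ 𝔫 D α₀ lam mu u w = α₀ * (d * lam + 2 * mu) * ∑ E ∈ M.interiorOrDirichlet D,
      (faceSize E)⁻¹ * area E * inner ℝ (jump 𝔫 E u (ctr E)) (jump 𝔫 E w (ctr E)) := by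
  rw [penalty₀]
  congr 1
  refine Finset.sum_congr rfl fun E hE => ?_
  have hEf := interiorOrDirichlet_subset hD hE
  rw [jumpOn_eq, faceMean_jumpOn 𝔫 hd hEf]
  have h (x : Vec d) : inner ℝ ((faceSize E)⁻¹ • jump 𝔫 E u x) (jump 𝔫 E w (ctr E)) =
      (faceSize E)⁻¹ * inner ℝ (jump 𝔫 E w (ctr E)) (jump 𝔫 E u x) := by
    rw [real_inner_smul_left, real_inner_comm]
  simp_rw [h]
  rw [integral_const_mul, setIntegral_inner_affineMap hd hEf, mul_assoc, real_inner_comm]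

theorem penalty₁_eq (u w : M.VDG) :
    penalty₁ 𝔫 D α₁ mu u w = α₁ * (2 * mu) * ∑ E ∈ M.interiorOrDirichlet D,
      (faceSize E)⁻¹ * faceProd E (jump 𝔫 E u) (jump 𝔫 E w) := by
  rw [penalty₁]
  congr 1
  refine Finset.sum_congr rfl fun E _ => ?_
  rw [jumpOn_eq, jumpOn_eq, faceProd, ← integral_const_mul]
  simp_rw [real_inner_smul_left]

theorem volumeTerm_comm (u w : M.VDG) : volumeTerm lam mu u w = volumeTerm lam mu w u := by
  rw [volumeTerm_eq, volumeTerm_eq]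
  refine Finset.sum_congr rfl fun T _ => ?_
  rw [frobenius_elasticity, frobenius_elasticity, frobenius_comm]
  ring

theorem penalty₀_comm (hd : 0 < d) (hD : D ⊆ M.boundaryFaces) (u w : M.VDG) :
    penalty₀ 𝔫 D α₀ lam mu u w = penalty₀ 𝔫 D α₀ lam mu w u := by
  simp only [penalty₀_eq 𝔫 _ _ _ hd hD, real_inner_comm]

theorem penalty₁_comm (u w : M.VDG) : penalty₁ 𝔫 D α₁ mu u w = penalty₁ 𝔫 D α₁ mu w u := by
  simp only [penalty₁_eq, faceProd_comm]

theorem formA_comm (hd : 0 < d) (hD : D ⊆ M.boundaryFaces) (u w : M.VDG) :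
    formA 𝔫 D α₀ α₁ lam mu (-1) u w = formA 𝔫 D α₀ α₁ lam mu (-1) w u := by
  rw [formA, formA, volumeTerm_comm, penalty₀_comm 𝔫 _ _ _ hd hD, penalty₁_comm]
  ring

theorem symGrad_add (u w : Vec d →ᵃ[ℝ] Vec d) : symGrad (u + w) = symGrad u + symGrad w := by
  ext i j
  simp [symGrad, gradient]
  ring

theorem elasticity_add (A B : Matrix (Fin d) (Fin d) ℝ) :
    elasticity lam mu (A + B) = elasticity lam mu A + elasticity lam mu B := by
  simp only [elasticity, Matrix.trace_add]
  module

theorem avgNormalStress_add (u w : M.VDG) (E : Finset (Vec d)) :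
    avgNormalStress 𝔫 lam mu (u + w) E =
      avgNormalStress 𝔫 lam mu u E + avgNormalStress 𝔫 lam mu w E := by
  simp only [avgNormalStress, Pi.add_apply, symGrad_add, elasticity_add, Matrix.add_mulVec,
    WithLp.toLp_add, avg, plusTrace, minusTrace, Finset.sum_add_distrib]
  split_ifs
  · module
  · rfl

theorem formA_add_left (hd : 0 < d) (hD : D ⊆ M.boundaryFaces) (u u' w : M.VDG) :
    formA 𝔫 D α₀ α₁ lam mu (-1) (u + u') w =
      formA 𝔫 D α₀ α₁ lam mu (-1) u w + formA 𝔫 D α₀ α₁ lam mu (-1) u' w := by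
  have hv : volumeTerm lam mu (u + u') w = volumeTerm lam mu u w + volumeTerm lam mu u' w := by
    simp only [volumeTerm_eq, Pi.add_apply, symGrad_add, elasticity_add, frobenius_add_left,
      mul_add, Finset.sum_add_distrib]
  have hc : consistencyTerm 𝔫 D lam mu (u + u') w =
      consistencyTerm 𝔫 D lam mu u w + consistencyTerm 𝔫 D lam mu u' w := by
    simp only [consistencyTerm_eq 𝔫 _ _ hd hD, avgNormalStress_add, inner_add_left, mul_add,
      Finset.sum_add_distrib]
  have hc' : consistencyTerm 𝔫 D lam mu w (u + u') =
      consistencyTerm 𝔫 D lam mu w u + consistencyTerm 𝔫 D lam mu w u' := by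
    simp only [consistencyTerm_eq 𝔫 _ _ hd hD, jump_add, AffineMap.coe_add, Pi.add_apply,
      inner_add_right, mul_add, Finset.sum_add_distrib]
  have hp : penalty₀ 𝔫 D α₀ lam mu (u + u') w =
      penalty₀ 𝔫 D α₀ lam mu u w + penalty₀ 𝔫 D α₀ lam mu u' w := by
    simp only [penalty₀_eq 𝔫 _ _ _ hd hD, jump_add, AffineMap.coe_add, Pi.add_apply,
      inner_add_left, mul_add, Finset.sum_add_distrib]
  have hq : penalty₁ 𝔫 D α₁ mu (u + u') w =
      penalty₁ 𝔫 D α₁ mu u w + penalty₁ 𝔫 D α₁ mu u' w := by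
    simp only [penalty₁_eq, jump_add]
    rw [← mul_add, ← Finset.sum_add_distrib]
    congr 1
    refine Finset.sum_congr rfl fun E hE => ?_
    rw [faceProd_add_left (interiorOrDirichlet_subset hD hE), mul_add]
  rw [formA, formA, formA, hv, hc, hc', hp, hq]
  ring

theorem splitFormA_self (hd : 0 < d) (hD : D ⊆ M.boundaryFaces) (z : Zspace 𝔫 D) (v : VCR 𝔫 D) :
    splitFormA 𝔫 D α₀ α₁ lam mu (-1) (z, v) (z, v) =
      formA 𝔫 D α₀ α₁ lam mu (-1) z.1 z.1 + 2 * formA 𝔫 D α₀ α₁ lam mu (-1) z.1 v.1 +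
        formA 𝔫 D α₀ α₁ lam mu (-1) v.1 v.1 := by
  rw [splitFormA, formA_add_left 𝔫 _ _ _ _ hd hD, formA_comm 𝔫 _ _ _ _ hd hD z.1,
    formA_comm 𝔫 _ _ _ _ hd hD v.1, formA_add_left 𝔫 _ _ _ _ hd hD,
    formA_add_left 𝔫 _ _ _ _ hd hD, formA_comm 𝔫 _ _ _ _ hd hD v.1 z.1]
  ring

open Classical in
/-- The outward unit normal of a cell on one of its faces. -/
def cellNormal (T : M.cells) (E : Finset (Vec d)) : Vec d :=
  if T ∈ plusCells 𝔫 E then 𝔫.normal E else -𝔫.normal E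

theorem isOutwardNormal_cellNormal (hd : 0 < d) (T : M.cells) (p : T.1) :
    IsOutwardNormal T.1 (opp T p) (cellNormal 𝔫 T (opp T p)) := by
  rw [cellNormal]
  split_ifs with h
  · exact ((mem_plusCells 𝔫).1 h).2
  · have := (mem_plusCells_or_minusCells 𝔫 hd (opp_mem_faces T p)).2 (opp_subset T p)
    exact ((mem_minusCells 𝔫).1 (this.resolve_left h)).2

/-- Summation by parts: on `𝒵` the volume term is the consistency term. -/
theorem volumeTerm_eq_consistencyTerm (hd : 0 < d) (hD : D ⊆ M.boundaryFaces) (u : M.VDG)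
    {z : M.VDG} (hz : z ∈ Zspace 𝔫 D) :
    volumeTerm lam mu u z = consistencyTerm 𝔫 D lam mu u z := by
  rw [mem_Zspace_iff 𝔫 hd] at hz
  set S : M.cells → Finset (Vec d) → Vec d := fun T E =>
    WithLp.toLp 2 ((elasticity lam mu (symGrad (u T))).mulVec (WithLp.ofLp (𝔫.normal E))) with hS
  let F : M.cells → Finset (Vec d) → ℝ := fun T E => area E * inner ℝ (WithLp.toLp 2
    ((elasticity lam mu (symGrad (u T))).mulVec (WithLp.ofLp (cellNormal 𝔫 T E)))) (z T (ctr E))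
  have hcell (T : M.cells) : (volume : Measure (Vec d)).real (hull T.1) *
      frobenius (elasticity lam mu (symGrad (u T))) (symGrad (z T)) =
        ∑ p : T.1, F T (opp T p) :=
    volume_mul_frobenius_symGrad hd (isOutwardNormal_cellNormal 𝔫 hd T)
      (elasticity_transpose (symGrad_transpose _)) _
  have hplus (T : M.cells) (E : Finset (Vec d)) (hT : T ∈ plusCells 𝔫 E) :
      F T E = area E * inner ℝ (S T E) (z T (ctr E)) := by
    simp only [F, cellNormal, if_pos hT, hS]
  have hminus (T : M.cells) (E : Finset (Vec d)) (hE : E ∈ M.faces) (hT : T ∈ minusCells 𝔫 E) :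
      F T E = -(area E * inner ℝ (S T E) (z T (ctr E))) := by
    have hn : T ∉ plusCells 𝔫 E :=
      Finset.disjoint_right.1 (disjoint_plusCells_minusCells 𝔫 hd hE) hT
    simp only [F, cellNormal, if_neg hn, hS]
    rw [WithLp.ofLp_neg, Matrix.mulVec_neg, WithLp.toLp_neg, inner_neg_left, mul_neg]
  have hstress (E : Finset (Vec d)) :
      avgNormalStress 𝔫 lam mu u E = avg 𝔫 E fun T => S T E := rfl
  rw [volumeTerm_eq, Finset.sum_congr rfl fun T _ => hcell T, sum_cells_eq_sum_faces 𝔫 hd,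
    consistencyTerm_eq 𝔫 _ _ hd hD, ← Finset.sum_subset (interiorOrDirichlet_subset hD)]
  · refine Finset.sum_congr rfl fun E hE => ?_
    have hEf := interiorOrDirichlet_subset hD hE
    rw [hstress]
    rcases face_cases 𝔫 D hd hEf with ⟨hi, h1, h2, P, Q, hP, hQ⟩ | ⟨hb, h1, h2, P, hP, hQ⟩ |
      ⟨hb, h1, h2, P, hP, hQ⟩
    -- The zero average means `z⁻ = -z⁺`, so `[z] = 2 z⁺`. The outward tractions carry opposite
    -- signs, and the two contributions add up to `⟨S⁺ + S⁻, z⁺⟩ = ⟨{S}, [z]⟩`.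
    · have ha := hz E h2
      rw [avg_of_interior 𝔫 hi hP hQ, AffineMap.coe_smul, Pi.smul_apply, AffineMap.coe_add,
        Pi.add_apply, smul_eq_zero] at ha
      have ha' : z Q (ctr E) = -z P (ctr E) := (neg_eq_of_add_eq_zero_right
        (ha.resolve_left (by norm_num))).symm
      rw [hP, hQ, Finset.sum_singleton, Finset.sum_singleton, hplus P E (by simp [hP]),
        hminus Q E hEf (by simp [hQ]), avg_of_interior 𝔫 hi hP hQ, jump_of_interior 𝔫 hi hP hQ,
        AffineMap.coe_sub, Pi.sub_apply, ha', sub_neg_eq_add, inner_neg_right, inner_add_right,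
        real_inner_smul_left, inner_add_left]
      ring
    · rw [hP, hQ, Finset.sum_singleton, Finset.sum_empty, hplus P E (by simp [hP]),
        avg_of_boundary 𝔫 hb hP, jump_of_boundary 𝔫 hb hP, add_zero]
    · exact absurd hE h1
  · intro E hEf hE
    rcases face_cases 𝔫 D hd hEf with ⟨hi, h1, h2, P, Q, hP, hQ⟩ | ⟨hb, h1, h2, P, hP, hQ⟩ |
      ⟨hb, h1, h2, P, hP, hQ⟩
    · exact absurd h1 hE
    · exact absurd h1 hE
    · have ha := hz E h2
      rw [avg_of_boundary 𝔫 hb hP] at ha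
      rw [hP, hQ, Finset.sum_singleton, Finset.sum_empty, hplus P E (by simp [hP]), ha,
        inner_zero_right, mul_zero, add_zero]

end Terms

end Mesh

/-! ### Global estimates for the gradient and the jumps. -/

namespace Mesh

variable {d : ℕ} {M : Mesh d} (𝔫 : M.FaceNormals) {D : Finset (Finset (Vec d))}

section Estimates

/-- The squared `L²` norm of the broken gradient. -/
def gradEnergy (u : M.VDG) : ℝ :=
  ∑ T : M.cells, (volume : Measure (Vec d)).real (hull T.1) *
    frobenius (gradient (u T)) (gradient (u T))

/-- The weighted sum of the squared mean jumps. -/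
def meanJumpEnergy (D : Finset (Finset (Vec d))) (u : M.VDG) : ℝ :=
  ∑ E ∈ M.interiorOrDirichlet D, (faceSize E)⁻¹ * area E *
    inner ℝ (jump 𝔫 E u (ctr E)) (jump 𝔫 E u (ctr E))

/-- The weighted squared `L²` norm of the mean-free parts of the jumps. -/
def oscJumpEnergy (D : Finset (Finset (Vec d))) (u : M.VDG) : ℝ :=
  ∑ E ∈ M.interiorOrDirichlet D, (faceSize E)⁻¹ *
    faceProd E (meanFree E (jump 𝔫 E u)) (meanFree E (jump 𝔫 E u))

theorem meanJumpEnergy_nonneg (u : M.VDG) : 0 ≤ meanJumpEnergy 𝔫 D u :=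
  Finset.sum_nonneg fun _ _ => mul_nonneg
    (mul_nonneg (inv_nonneg.2 (faceSize_nonneg _)) measureReal_nonneg) real_inner_self_nonneg

theorem oscJumpEnergy_nonneg (u : M.VDG) : 0 ≤ oscJumpEnergy 𝔫 D u :=
  Finset.sum_nonneg fun _ _ => mul_nonneg (inv_nonneg.2 (faceSize_nonneg _))
    (faceProd_self_nonneg _ _)

/-- The inverse estimate bounds the gradient by the values at face barycentres. On `𝒵` these are
half of the jump up to sign on interior faces, the jump itself on Dirichlet faces, and zero on
Neumann faces. -/
theorem gradEnergy_le (hd : 2 ≤ d) {σ : ℝ} (hσ : 0 < σ) (hM : M.ShapeRegular σ)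
    (hD : D ⊆ M.boundaryFaces) {z : M.VDG} (hz : z ∈ Zspace 𝔫 D) :
    gradEnergy z ≤ d * (d + 1) * σ * meanJumpEnergy 𝔫 D z := by
  have hd0 : 0 < d := by omega
  rw [mem_Zspace_iff 𝔫 hd0] at hz
  let F : M.cells → Finset (Vec d) → ℝ := fun T E =>
    (faceSize E)⁻¹ * area E * ‖z T (ctr E)‖ ^ 2
  have h1 : gradEnergy z ≤ d * (d + 1) * σ * ∑ T : M.cells, ∑ p : T.1, F T (opp T p) := by
    rw [gradEnergy, Finset.mul_sum]
    exact Finset.sum_le_sum fun T _ => volume_mul_frobenius_gradient_le hd hσ hM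
      (isOutwardNormal_cellNormal 𝔫 hd0 T) (z T)
  refine h1.trans (mul_le_mul_of_nonneg_left ?_ (by positivity))
  rw [sum_cells_eq_sum_faces 𝔫 hd0, meanJumpEnergy,
    ← Finset.sum_subset (interiorOrDirichlet_subset hD)]
  · refine Finset.sum_le_sum fun E hE => ?_
    have hEf := interiorOrDirichlet_subset hD hE
    have hw : 0 ≤ (faceSize E)⁻¹ * area E :=
      mul_nonneg (inv_nonneg.2 (faceSize_nonneg _)) measureReal_nonneg
    rw [real_inner_self_eq_norm_sq]
    rcases face_cases 𝔫 D hd0 hEf with ⟨hi, h1, h2, P, Q, hP, hQ⟩ | ⟨hb, h1, h2, P, hP, hQ⟩ |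
      ⟨hb, h1, h2, P, hP, hQ⟩
    · have ha := hz E h2
      rw [avg_of_interior 𝔫 hi hP hQ, AffineMap.coe_smul, Pi.smul_apply, AffineMap.coe_add,
        Pi.add_apply, smul_eq_zero] at ha
      have ha' : z Q (ctr E) = -z P (ctr E) := (neg_eq_of_add_eq_zero_right
        (ha.resolve_left (by norm_num))).symm
      rw [hP, hQ, Finset.sum_singleton, Finset.sum_singleton, jump_of_interior 𝔫 hi hP hQ,
        AffineMap.coe_sub, Pi.sub_apply]
      simp only [F]
      rw [ha', sub_neg_eq_add, ← two_smul ℝ, norm_smul, norm_neg, ← mul_add]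
      refine mul_le_mul_of_nonneg_left ?_ hw
      rw [mul_pow, Real.norm_ofNat]
      nlinarith [sq_nonneg ‖z P (ctr E)‖]
    · rw [hP, hQ, Finset.sum_singleton, Finset.sum_empty, jump_of_boundary 𝔫 hb hP, add_zero]
    · exact absurd hE h1
  · intro E hEf hE
    rcases face_cases 𝔫 D hd0 hEf with ⟨hi, h1, h2, P, Q, hP, hQ⟩ | ⟨hb, h1, h2, P, hP, hQ⟩ |
      ⟨hb, h1, h2, P, hP, hQ⟩
    · exact absurd h1 hE
    · exact absurd h1 hE
    · have ha := hz E h2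
      rw [avg_of_boundary 𝔫 hb hP] at ha
      simp [F, hP, hQ, ha]

theorem volumeTerm_self_le {lam mu : ℝ} (hl : 0 ≤ lam) (hm : 0 ≤ mu) (u : M.VDG) :
    volumeTerm lam mu u u ≤ (d * lam + 2 * mu) * gradEnergy u := by
  rw [volumeTerm_eq, gradEnergy, Finset.mul_sum]
  refine Finset.sum_le_sum fun T _ => ?_
  rw [mul_left_comm]
  refine mul_le_mul_of_nonneg_left ?_ measureReal_nonneg
  exact (frobenius_elasticity_self_le hl _).trans
    (mul_le_mul_of_nonneg_left (frobenius_symGrad_self_le _) (by positivity))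

theorem volumeTerm_self_nonneg {lam mu : ℝ} (hl : 0 ≤ lam) (hm : 0 ≤ mu) (u : M.VDG) :
    0 ≤ volumeTerm lam mu u u := by
  rw [volumeTerm_eq]
  exact Finset.sum_nonneg fun _ _ => mul_nonneg measureReal_nonneg
    (frobenius_elasticity_self_nonneg hl hm _)

/-- A trace estimate, valid for every piecewise affine field: the mean-free jump on `E` is bounded
by `h_E` times the adjacent gradients, `h_E |E| ≤ d σ |T|`, and a cell has `d + 1` faces. -/
theorem oscJumpEnergy_le (hd : 2 ≤ d) {σ : ℝ} (hσ : 0 < σ) (hM : M.ShapeRegular σ)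
    (hD : D ⊆ M.boundaryFaces) (u : M.VDG) :
    oscJumpEnergy 𝔫 D u ≤ 2 * (d * (d + 1) * σ) * gradEnergy u := by
  have hd0 : 0 < d := by omega
  let N : M.cells → ℝ := fun T => frobenius (gradient (u T)) (gradient (u T))
  have hN (T : M.cells) : 0 ≤ N T := frobenius_self_nonneg _
  -- The factor `2` comes from `‖a - b‖² ≤ 2 (‖a‖² + ‖b‖²)` on interior faces; on Dirichlet faces it
  -- is merely generous.
  let F : M.cells → Finset (Vec d) → ℝ := fun T E => 2 * (faceSize E * area E) * N T
  have hF (T : M.cells) (E : Finset (Vec d)) : 0 ≤ F T E :=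
    mul_nonneg (mul_nonneg zero_le_two (mul_nonneg (faceSize_nonneg E) measureReal_nonneg)) (hN T)
  have hface (E : Finset (Vec d)) (hE : E ∈ M.interiorOrDirichlet D) : (faceSize E)⁻¹ *
      faceProd E (meanFree E (jump 𝔫 E u)) (meanFree E (jump 𝔫 E u)) ≤
        ∑ T ∈ plusCells 𝔫 E, F T E + ∑ T ∈ minusCells 𝔫 E, F T E := by
    have hEf := interiorOrDirichlet_subset hD hE
    have hs := faceSize_pos hd hEf
    have key (L : ℝ) (hL : 0 ≤ L) (hf : ∀ y, ‖(jump 𝔫 E u).linear y‖ ^ 2 ≤ L * ‖y‖ ^ 2) :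
        (faceSize E)⁻¹ * faceProd E (meanFree E (jump 𝔫 E u)) (meanFree E (jump 𝔫 E u)) ≤
          L * (faceSize E * area E) := by
      refine (mul_le_mul_of_nonneg_left (faceProd_meanFree_self_le_of_linear hd0 hEf hL hf)
        (inv_pos.2 hs).le).trans_eq ?_
      field_simp
    rcases face_cases 𝔫 D hd0 hEf with ⟨hi, h1, h2, P, Q, hP, hQ⟩ | ⟨hb, h1, h2, P, hP, hQ⟩ |
      ⟨hb, h1, h2, P, hP, hQ⟩
    · refine (key (2 * (N P + N Q)) (by linarith [hN P, hN Q]) fun y => ?_).trans_eq ?_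
      · rw [jump_of_interior 𝔫 hi hP hQ, AffineMap.sub_linear, LinearMap.sub_apply]
        have hP' := norm_sq_linear_le (u P) y
        have hQ' := norm_sq_linear_le (u Q) y
        have htri := norm_sub_le ((u P).linear y) ((u Q).linear y)
        have h0 := norm_nonneg ((u P).linear y - (u Q).linear y)
        have hsq := pow_le_pow_left₀ h0 htri 2
        simp only [N]
        nlinarith [sq_nonneg (‖(u P).linear y‖ - ‖(u Q).linear y‖)]
      · rw [hP, hQ, Finset.sum_singleton, Finset.sum_singleton]
        simp only [F]
        ring
    · refine (key (N P) (hN P) fun y => ?_).trans ?_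
      · rw [jump_of_boundary 𝔫 hb hP]
        exact norm_sq_linear_le (u P) y
      · rw [hP, hQ, Finset.sum_singleton, Finset.sum_empty, add_zero]
        have := hF P E
        simp only [F] at this ⊢
        linarith
    · exact absurd hE h1
  calc oscJumpEnergy 𝔫 D u
      ≤ ∑ E ∈ M.interiorOrDirichlet D,
          (∑ T ∈ plusCells 𝔫 E, F T E + ∑ T ∈ minusCells 𝔫 E, F T E) :=
        Finset.sum_le_sum hface
    _ ≤ ∑ E ∈ M.faces, (∑ T ∈ plusCells 𝔫 E, F T E + ∑ T ∈ minusCells 𝔫 E, F T E) :=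
        Finset.sum_le_sum_of_subset_of_nonneg (interiorOrDirichlet_subset hD) fun E _ _ =>
          add_nonneg (Finset.sum_nonneg fun T _ => hF T E) (Finset.sum_nonneg fun T _ => hF T E)
    _ = ∑ T : M.cells, ∑ p : T.1, F T (opp T p) := (sum_cells_eq_sum_faces 𝔫 hd0 F).symm
    _ ≤ ∑ T : M.cells, ∑ p : T.1,
          2 * (d * σ * (volume : Measure (Vec d)).real (hull T.1)) * N T := by
        refine Finset.sum_le_sum fun T _ => Finset.sum_le_sum fun p _ => ?_
        exact mul_le_mul_of_nonneg_right (mul_le_mul_of_nonneg_left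
          (faceSize_mul_area_le hd0 hσ hM (isOutwardNormal_cellNormal 𝔫 hd0 T p)) zero_le_two)
          (hN T)
    _ = 2 * (d * (d + 1) * σ) * gradEnergy u := by
        rw [gradEnergy, Finset.mul_sum]
        refine Finset.sum_congr rfl fun T _ => ?_
        rw [Finset.sum_const, Finset.card_univ, Fintype.card_coe, M.card_eq T.1 T.2, nsmul_eq_mul]
        push_cast
        ring

/-- The Cauchy-Schwarz inequality for weighted `L²` products on faces. -/
theorem sq_sum_faceProd_le (hD : D ⊆ M.boundaryFaces)
    (f g : Finset (Vec d) → Vec d →ᵃ[ℝ] Vec d) :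
    (∑ E ∈ M.interiorOrDirichlet D, (faceSize E)⁻¹ * faceProd E (f E) (g E)) ^ 2 ≤
      (∑ E ∈ M.interiorOrDirichlet D, (faceSize E)⁻¹ * faceProd E (f E) (f E)) *
        ∑ E ∈ M.interiorOrDirichlet D, (faceSize E)⁻¹ * faceProd E (g E) (g E) := by
  set a := ∑ E ∈ M.interiorOrDirichlet D, (faceSize E)⁻¹ * faceProd E (f E) (f E) with ha
  set b := ∑ E ∈ M.interiorOrDirichlet D, (faceSize E)⁻¹ * faceProd E (f E) (g E) with hb
  set c := ∑ E ∈ M.interiorOrDirichlet D, (faceSize E)⁻¹ * faceProd E (g E) (g E) with hc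
  -- The quadratic is the weighted norm squared of `t g + f`; its discriminant is therefore not
  -- positive.
  have h (t : ℝ) : 0 ≤ c * (t * t) + 2 * b * t + a := by
    have h0 : 0 ≤ ∑ E ∈ M.interiorOrDirichlet D,
        (faceSize E)⁻¹ * faceProd E (t • g E + f E) (t • g E + f E) :=
      Finset.sum_nonneg fun E _ => mul_nonneg (inv_nonneg.2 (faceSize_nonneg E))
        (faceProd_self_nonneg _ _)
    refine h0.trans_eq ?_
    rw [ha, hb, hc, Finset.mul_sum, Finset.sum_mul, Finset.sum_mul, ← Finset.sum_add_distrib,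
      ← Finset.sum_add_distrib]
    refine Finset.sum_congr rfl fun E hE => ?_
    have hEf := interiorOrDirichlet_subset hD hE
    rw [faceProd_add_left hEf, faceProd_smul_left, faceProd_comm E (g E) (_ + _),
      faceProd_comm E (f E) (_ + _), faceProd_add_left hEf, faceProd_smul_left,
      faceProd_add_left hEf, faceProd_smul_left, faceProd_comm E (g E) (f E)]
    ring
  have := discrim_le_zero h
  rw [discrim] at this
  linarith

theorem sum_faceProd_self_ge (hd : 0 < d) (hD : D ⊆ M.boundaryFaces) (u : M.VDG) :
    oscJumpEnergy 𝔫 D u ≤ ∑ E ∈ M.interiorOrDirichlet D,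
      (faceSize E)⁻¹ * faceProd E (jump 𝔫 E u) (jump 𝔫 E u) :=
  Finset.sum_le_sum fun _ hE => mul_le_mul_of_nonneg_left
    (faceProd_meanFree_self_le hd (interiorOrDirichlet_subset hD hE) _)
    (inv_nonneg.2 (faceSize_nonneg _))

end Estimates

/-! ### The form on each subspace and between them. -/

section Form

variable {α₀ α₁ lam mu : ℝ}

/-- The averaged normal stress is constant on a face, so it only sees the mean of the jump. -/
theorem consistencyTerm_of_mem_VCR (hd : 0 < d) (hD : D ⊆ M.boundaryFaces) (u : M.VDG) {v : M.VDG}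
    (hv : v ∈ VCR 𝔫 D) : consistencyTerm 𝔫 D lam mu u v = 0 := by
  rw [mem_VCR_iff 𝔫 hd hD] at hv
  rw [consistencyTerm_eq 𝔫 _ _ hd hD]
  refine Finset.sum_eq_zero fun E hE => ?_
  rw [hv E hE, inner_zero_right, mul_zero]

theorem penalty₀_of_mem_VCR (hd : 0 < d) (hD : D ⊆ M.boundaryFaces) (u : M.VDG) {v : M.VDG}
    (hv : v ∈ VCR 𝔫 D) : penalty₀ 𝔫 D α₀ lam mu u v = 0 := by
  rw [mem_VCR_iff 𝔫 hd hD] at hv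
  rw [penalty₀_eq 𝔫 _ _ _ hd hD, Finset.sum_eq_zero, mul_zero]
  intro E hE
  rw [hv E hE, inner_zero_right, mul_zero]

/-- The two subspaces interact through the full penalty term only. -/
theorem formA_Zspace_VCR (hd : 0 < d) (hD : D ⊆ M.boundaryFaces) {z v : M.VDG}
    (hz : z ∈ Zspace 𝔫 D) (hv : v ∈ VCR 𝔫 D) :
    formA 𝔫 D α₀ α₁ lam mu (-1) z v = penalty₁ 𝔫 D α₁ mu z v := by
  rw [formA, volumeTerm_comm, volumeTerm_eq_consistencyTerm 𝔫 _ _ hd hD v hz,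
    consistencyTerm_of_mem_VCR 𝔫 hd hD z hv, penalty₀_of_mem_VCR 𝔫 hd hD z hv]
  ring

/-- On `V^CR` the form is the nonnegative elastic energy plus the full penalty. -/
theorem penalty₁_le_formA_VCR (hd : 0 < d) (hD : D ⊆ M.boundaryFaces) (hl : 0 ≤ lam) (hm : 0 ≤ mu)
    {v : M.VDG} (hv : v ∈ VCR 𝔫 D) :
    penalty₁ 𝔫 D α₁ mu v v ≤ formA 𝔫 D α₀ α₁ lam mu (-1) v v := by
  rw [formA, consistencyTerm_of_mem_VCR 𝔫 hd hD v hv, penalty₀_of_mem_VCR 𝔫 hd hD v hv]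
  linarith [volumeTerm_self_nonneg hl hm v]

/-- On `𝒵` both consistency terms equal the elastic energy, which thus enters with the total sign
`-1`. It is at most `d (d + 1) σ β₀` times the mean-jump sum, which half of the reduced penalty
absorbs. The full penalty is kept through its mean-free part. -/
theorem formA_Zspace_ge (hd : 2 ≤ d) {σ : ℝ} (hσ : 0 < σ) (hM : M.ShapeRegular σ)
    (hD : D ⊆ M.boundaryFaces) (hα₀ : 2 * (d * (d + 1) * σ) ≤ α₀) (hα₁ : 0 ≤ α₁) (hl : 0 ≤ lam)
    (hm : 0 ≤ mu) {z : M.VDG} (hz : z ∈ Zspace 𝔫 D) :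
    α₀ / 2 * ((d * lam + 2 * mu) * meanJumpEnergy 𝔫 D z)
      + α₁ * (2 * mu) * oscJumpEnergy 𝔫 D z ≤ formA 𝔫 D α₀ α₁ lam mu (-1) z z := by
  have hd0 : 0 < d := by omega
  have hβ : 0 ≤ d * lam + 2 * mu := by positivity
  have h1 := volumeTerm_self_le hl hm z
  have h2 := mul_le_mul_of_nonneg_left (gradEnergy_le 𝔫 hd hσ hM hD hz) hβ
  have h3 := mul_nonneg hβ (meanJumpEnergy_nonneg 𝔫 (D := D) z)
  have h4 := mul_le_mul_of_nonneg_right hα₀ h3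
  have h5 := mul_le_mul_of_nonneg_left (sum_faceProd_self_ge 𝔫 hd0 hD z)
    (show 0 ≤ α₁ * (2 * mu) by positivity)
  have h6 : penalty₀ 𝔫 D α₀ lam mu z z = α₀ * ((d * lam + 2 * mu) * meanJumpEnergy 𝔫 D z) := by
    rw [penalty₀_eq 𝔫 _ _ _ hd0 hD, meanJumpEnergy, mul_assoc]
  rw [formA, ← volumeTerm_eq_consistencyTerm 𝔫 _ _ hd0 hD z hz, h6, penalty₁_eq]
  linarith

/-- Replacing the jump of `z` by its mean-free part before Cauchy-Schwarz is what later yields `γ <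
1`: the mean part of the jump is left over as a strict surplus in `𝒜(z, z)`. -/
theorem sq_formA_Zspace_VCR_le (hd : 0 < d) (hD : D ⊆ M.boundaryFaces) (hα₁ : 0 ≤ α₁)
    (hl : 0 ≤ lam) (hm : 0 ≤ mu) {z v : M.VDG} (hz : z ∈ Zspace 𝔫 D) (hv : v ∈ VCR 𝔫 D) :
    formA 𝔫 D α₀ α₁ lam mu (-1) z v ^ 2 ≤
      α₁ * (2 * mu) * oscJumpEnergy 𝔫 D z * formA 𝔫 D α₀ α₁ lam mu (-1) v v := by
  have hv' := (mem_VCR_iff 𝔫 hd hD).1 hv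
  have h1 : ∑ E ∈ M.interiorOrDirichlet D,
      (faceSize E)⁻¹ * faceProd E (jump 𝔫 E z) (jump 𝔫 E v) = ∑ E ∈ M.interiorOrDirichlet D,
        (faceSize E)⁻¹ * faceProd E (meanFree E (jump 𝔫 E z)) (jump 𝔫 E v) := by
    refine Finset.sum_congr rfl fun E hE => ?_
    rw [faceProd_eq_meanFree hd (interiorOrDirichlet_subset hD hE), hv' E hE, inner_zero_right,
      mul_zero, add_zero]
  have h2 := sq_sum_faceProd_le hD (fun E => meanFree E (jump 𝔫 E z)) (jump 𝔫 · v)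
  have hw : 0 ≤ α₁ * (2 * mu) := by positivity
  have h3 := penalty₁_le_formA_VCR 𝔫 (α₀ := α₀) (α₁ := α₁) hd hD hl hm hv
  have h4 := mul_le_mul_of_nonneg_left h3 (mul_nonneg hw (oscJumpEnergy_nonneg 𝔫 (D := D) z))
  refine le_trans ?_ h4
  rw [formA_Zspace_VCR 𝔫 hd hD hz hv, penalty₁_eq, penalty₁_eq, h1, mul_pow]
  refine (mul_le_mul_of_nonneg_left h2 (sq_nonneg _)).trans_eq ?_
  rw [oscJumpEnergy]
  ring

end Form

end Mesh

end DGElasticity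

end

/-! ### The strengthened Cauchy-Schwarz inequality and the spectral equivalence. -/

open DGElasticity DGElasticity.Mesh in
theorem theorem4p1 (d : ℕ) (hd : d = 2 ∨ d = 3) (σ : ℝ) (hσ : 0 < σ) :
    ∃ αmin : ℝ, 0 < αmin ∧ ∀ α₀ : ℝ, αmin ≤ α₀ → ∀ α₁ : ℝ, 0 < α₁ →
      ∃ γ : ℝ, 0 ≤ γ ∧ γ < 1 ∧
        ∀ (M : Mesh d), M.ShapeRegular σ → ∀ (𝔫 : M.FaceNormals)
          (D : Finset (Finset (Vec d))), D ⊆ M.boundaryFaces →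
        ∀ mu lam : ℝ, 0 < mu → 0 ≤ lam →
          IsCompl (VCR 𝔫 D) (Zspace 𝔫 D) ∧
          ∀ (z : Zspace 𝔫 D) (v : VCR 𝔫 D),
            formA 𝔫 D α₀ α₁ lam mu (-1) z.1 v.1 ^ 2 ≤
              γ ^ 2 * formA 𝔫 D α₀ α₁ lam mu (-1) z.1 z.1 *
                formA 𝔫 D α₀ α₁ lam mu (-1) v.1 v.1 ∧
            1 / (1 + γ) * splitFormA 𝔫 D α₀ α₁ lam mu (-1) (z, v) (z, v) ≤
              blockFormB 𝔫 D α₀ α₁ lam mu (-1) (z, v) (z, v) ∧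
            blockFormB 𝔫 D α₀ α₁ lam mu (-1) (z, v) (z, v) ≤
              1 / (1 - γ) * splitFormA 𝔫 D α₀ α₁ lam mu (-1) (z, v) (z, v) := by
  have hd2 : 2 ≤ d := by omega
  have hd0 : 0 < d := by omega
  set C : ℝ := d * (d + 1) * σ with hC
  have hCpos : 0 < C := by positivity
  refine ⟨2 * C, by positivity, fun α₀ hα₀ α₁ hα₁ => ?_⟩
  have hα₀pos : 0 < α₀ := by linarith
  -- The constant in `q ≤ K β₀ S`: a factor `2 C` from the trace estimate and `C` from the gradient
  -- bound.
  set K : ℝ := α₁ * (2 * C * C) with hK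
  have hKpos : 0 < K := by positivity
  have hγ2 : Real.sqrt (K / (K + α₀ / 2)) ^ 2 = K / (K + α₀ / 2) := Real.sq_sqrt (by positivity)
  refine ⟨Real.sqrt (K / (K + α₀ / 2)), Real.sqrt_nonneg _, ?_, ?_⟩
  · rw [Real.sqrt_lt' one_pos, one_pow, div_lt_one (by positivity)]
    linarith
  have hγ1 : Real.sqrt (K / (K + α₀ / 2)) < 1 := by
    rw [Real.sqrt_lt' one_pos, one_pow, div_lt_one (by positivity)]
    linarith
  have hγ0 := Real.sqrt_nonneg (K / (K + α₀ / 2))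
  set γ := Real.sqrt (K / (K + α₀ / 2)) with hγ
  intro M hM 𝔫 D hD mu lam hmu hlam
  refine ⟨isCompl_VCR_Zspace 𝔫 hd0 hD, fun z v => ?_⟩
  have hzz := formA_Zspace_ge 𝔫 hd2 hσ hM hD hα₀ hα₁.le hlam hmu.le z.2
  have hzv := sq_formA_Zspace_VCR_le (α₀ := α₀) 𝔫 hd0 hD hα₁.le hlam hmu.le z.2 v.2
  have hvv0 : 0 ≤ formA 𝔫 D α₀ α₁ lam mu (-1) v.1 v.1 := by
    refine le_trans ?_ (penalty₁_le_formA_VCR 𝔫 hd0 hD hlam hmu.le v.2)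
    rw [penalty₁_eq]
    exact mul_nonneg (by positivity) (Finset.sum_nonneg fun E _ => mul_nonneg
      (inv_nonneg.2 (faceSize_nonneg E)) (faceProd_self_nonneg _ _))
  have hsplit := splitFormA_self 𝔫 α₀ α₁ lam mu hd0 hD z v
  have hblock : blockFormB 𝔫 D α₀ α₁ lam mu (-1) (z, v) (z, v) =
      formA 𝔫 D α₀ α₁ lam mu (-1) z.1 z.1 + formA 𝔫 D α₀ α₁ lam mu (-1) v.1 v.1 := rfl
  have hosc := oscJumpEnergy_le 𝔫 hd2 hσ hM hD z.1
  have hgrad := gradEnergy_le 𝔫 hd2 hσ hM hD z.2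
  have hS := meanJumpEnergy_nonneg 𝔫 (D := D) z.1
  have hQ := oscJumpEnergy_nonneg 𝔫 (D := D) z.1
  rw [← hC] at hosc hgrad
  rw [hsplit, hblock]
  set a := formA 𝔫 D α₀ α₁ lam mu (-1) z.1 z.1
  set b := formA 𝔫 D α₀ α₁ lam mu (-1) z.1 v.1
  set c := formA 𝔫 D α₀ α₁ lam mu (-1) v.1 v.1
  set S := meanJumpEnergy 𝔫 D z.1
  set Q := oscJumpEnergy 𝔫 D z.1
  set β : ℝ := d * lam + 2 * mu
  -- The inequality `β₁ ≤ β₀` removes the Lamé parameters: the full penalty scales with `β₁`, the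
  -- reduced penalty that dominates it with `β₀`.
  have hβ : 2 * mu ≤ β := by
    have : 0 ≤ d * lam := by positivity
    simp only [β]
    linarith
  have hβ0 : 0 ≤ β := by linarith
  set q := α₁ * (2 * mu) * Q with hq
  have hq0 : 0 ≤ q := by positivity
  have hqK : q ≤ K * (β * S) := by
    have h1 : Q ≤ 2 * C * (C * S) :=
      hosc.trans (mul_le_mul_of_nonneg_left hgrad (by positivity))
    calc q ≤ α₁ * (2 * mu) * (2 * C * (C * S)) :=
          mul_le_mul_of_nonneg_left h1 (by positivity)
      _ = K * (2 * mu * S) := by rw [hK]; ring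
      _ ≤ K * (β * S) := by gcongr
  have ha0 : 0 ≤ a := le_trans (by positivity) hzz
  -- From `a ≥ (α₀ / 2) β S + q` and `q ≤ K β S` one gets `K a ≥ (α₀ / 2 + K) q`, which fixes the
  -- choice of `γ`.
  have hqa : q ≤ γ ^ 2 * a := by
    rw [hγ2, div_mul_eq_mul_div, le_div_iff₀ (by positivity)]
    have h1 := mul_le_mul_of_nonneg_left hzz hKpos.le
    have h2 := mul_le_mul_of_nonneg_left hqK (show 0 ≤ α₀ / 2 by positivity)
    linarith
  have hcbs : b ^ 2 ≤ γ ^ 2 * a * c := hzv.trans (mul_le_mul_of_nonneg_right hqa hvv0)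
  -- Since `4 b² ≤ γ² · 4 a c ≤ γ² (a + c)²`, the sum `a + 2 b + c` lies between `(1 - γ) (a + c)`
  -- and `(1 + γ) (a + c)`.
  have habs : |2 * b| ≤ γ * (a + c) := by
    refine abs_le_of_sq_le_sq ?_ (by positivity)
    have h1 : 4 * (a * c) ≤ (a + c) ^ 2 := by linarith [sq_nonneg (a - c)]
    have h2 := mul_le_mul_of_nonneg_left h1 (sq_nonneg γ)
    linarith
  obtain ⟨hlo, hhi⟩ := abs_le.1 habs
  refine ⟨hcbs, ?_, ?_⟩
  · rw [one_div, inv_mul_le_iff₀ (by linarith)]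
    linarith
  · rw [one_div, le_inv_mul_iff₀ (by linarith)]
    linarith
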